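/- Let $X$ be a Cantor space (a nonempty compact metrizable totally disconnected space without isolated points), and let $K$ be a set of Borel probability measures on $X$. A homeomorphism $g$ of $X$ is minimal if every orbit $\{g^n(x) : n\in\mathbb Z\}$ is dense in $X$. Call $K$ a dynamical simplex if it is nonempty and (1) $K$ is convex, and compact in the weak-$*$ topology of the space of probability measures on $X$; (2) every $\mu\in K$ is atomless and has full support; (3) $K$ is good: whenever $A,B\subseteq X$ are clopen and $\mu(A)<\mu(B)$ for all $\mu\in K$, there is a clopen $C\subseteq B$ with $\mu(C)=\mu(A)$ for all $\mu\in K$; (4) $K$ is approximately divisible: for every clopen $A\subseteq X$, every integer $n\ge 1$ and every $\varepsilon>0$ there is a clopen $B\subseteq A$ with $n\mu(B)\in[\mu(A)-\varepsilon,\mu(A)]$ for all $\mu\in K$. Then there exists a minimal homeomorphism $g$ of $X$ whose set of invariant Borel probability measures is exactly $K$ if and only if $K$ is a dynamical simplex. Moreover, if $K$ is a dynamical simplex, then there is a minimal homeomorphism $g$ of $X$ whose set of invariant Borel probability measures is exactly $K$ and which is saturated: the topological full group $[[g]]$ is dense in the closure of the full group $[g]$. Here $[g]$ is the group of homeomorphisms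 $h$ of $X$ such that for every $x\in X$ there is $n\in\mathbb Z$ with $h(x)=g^n(x)$; $[[g]]$ is the group of homeomorphisms $h$ of $X$ for which there are a finite partition of $X$ into clopen sets $A_1,\dots,A_k$ and integers $n_1,\dots,n_k$ with $h(x)=g^{n_i}(x)$ for all $x\in A_i$; closures are taken in the group of homeomorphisms of $X$ with the topology of uniform convergence. -/

import Mathlib

open MeasureTheory Topology Set
open scoped NNReal

namespace CantorDynamics

section Dynamics

variable {X : Type*} [TopologicalSpace X]

/-- The topology of uniform convergence on the group of homeomorphisms of `X`, as the topology
induced by the compact-open topology of `C(X, X)`; for compact `X` the compact-open topology is the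
topology of uniform convergence. -/
instance homeoTopology : TopologicalSpace (X ≃ₜ X) :=
  TopologicalSpace.induced (fun h : X ≃ₜ X => (h : C(X, X))) inferInstance

/-- A homeomorphism is minimal if all its (two-sided) orbits are dense. -/
def IsMinimalHomeo (g : X ≃ₜ X) : Prop :=
  ∀ x : X, Dense (Set.range fun n : ℤ => (g ^ n) x)

/-- The topological full group `[[g]]`: the homeomorphisms `h` for which there are a finite
partition of `X` into clopen sets `A i` and integers `n i` with `h = g ^ (n i)` on `A i`. -/
def topologicalFullGroup (g : X ≃ₜ X) : Set (X ≃ₜ X) :=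
  {h | ∃ (k : ℕ) (A : Fin k → Set X) (n : Fin k → ℤ),
    (∀ i, IsClopen (A i)) ∧ Pairwise (fun i j => Disjoint (A i) (A j)) ∧ (⋃ i, A i) = univ ∧
      ∀ i, ∀ x ∈ A i, h x = (g ^ n i) x}

/-- The full group `[g]`: the homeomorphisms `h` mapping each point into its `g`-orbit. -/
def fullGroup (g : X ≃ₜ X) : Set (X ≃ₜ X) :=
  {h | ∀ x : X, ∃ n : ℤ, h x = (g ^ n) x}

/-- `g` is saturated if `[[g]]` is a dense subset of the closure of `[g]`, the closure being taken
in the group of homeomorphisms. -/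
def IsSaturated (g : X ≃ₜ X) : Prop :=
  topologicalFullGroup g ⊆ closure (fullGroup g) ∧
    closure (fullGroup g) ⊆ closure (topologicalFullGroup g)

end Dynamics

section Measures

variable {X : Type*} [TopologicalSpace X] [MeasurableSpace X]

/-- The set of `g`-invariant Borel probability measures. -/
def invariantMeasures (g : X ≃ₜ X) : Set (ProbabilityMeasure X) :=
  {μ | (μ : Measure X).map g = (μ : Measure X)}

/-- `K` is good: if `A`, `B` are clopen and `μ A < μ B` for all `μ ∈ K`, then some clopen subset
of `B` has the same measure as `A` for all `μ ∈ K`. -/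
def IsGood (K : Set (ProbabilityMeasure X)) : Prop :=
  ∀ A B : Set X, IsClopen A → IsClopen B → (∀ μ ∈ K, μ A < μ B) →
    ∃ C : Set X, IsClopen C ∧ C ⊆ B ∧ ∀ μ ∈ K, μ C = μ A

/-- `K` is approximately divisible: for every clopen `A`, every integer `n ≥ 1` and every `ε > 0`
there is a clopen `B ⊆ A` with `n μ(B) ∈ [μ(A) - ε, μ(A)]` for all `μ ∈ K`. -/
def IsApproximatelyDivisible (K : Set (ProbabilityMeasure X)) : Prop :=
  ∀ A : Set X, IsClopen A → ∀ n : ℕ, 1 ≤ n → ∀ ε : ℝ, 0 < ε →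
    ∃ B : Set X, IsClopen B ∧ B ⊆ A ∧
      ∀ μ ∈ K, (n : ℝ) * (μ B : ℝ) ∈ Icc ((μ A : ℝ) - ε) (μ A : ℝ)

/-- Dynamical simplices. Compactness refers to the weak topology on probability measures
(convergence of integrals of continuous functions); convexity is convexity in the
`ℝ≥0`-module of finite measures. -/
structure IsDynamicalSimplex [OpensMeasurableSpace X] (K : Set (ProbabilityMeasure X)) : Prop where
  nonempty : K.Nonempty
  isCompact : IsCompact K
  convex : Convex ℝ≥0 (ProbabilityMeasure.toFiniteMeasure '' K)
  atomless : ∀ μ ∈ K, ∀ x : X, (μ : Measure X) {x} = 0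
  fullSupport : ∀ μ ∈ K, (μ : Measure X).IsOpenPosMeasure
  good : IsGood K
  approximatelyDivisible : IsApproximatelyDivisible K

end Measures

end CantorDynamics

open CantorDynamics

/-!
The two implications rest on the combinatorics of clopen sets, where two clopen sets are
`K`-equivalent (`KEquiv`) if all measures in `K` give them the same mass.

**From `g` to `K`.** For a minimal `g`, goodness of the set of invariant measures is a parenthesis
matching. Read the points of `A` on an orbit as opening and those of `B` as closing parentheses. A
point of `A` with no partner would have positive partial sums of `1_A - 1_B`, hence, by the
Krylov–Bogoliubov construction (`exists_invariantMeasure`), there would be an invariant measure `μ`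
with `μ A ≥ μ B`. The matching `exists_matching` is continuous and moves points along orbits.
Approximate divisibility is a consequence of goodness: in `IsGoodSystem.exists_division` small
pieces of a clopen set are moved into a small clopen set `E` that serves as a counter modulo `n`,
and the carries are moved back to form the required `n`-th part.

**From `K` to `g`.** It suffices to find a homeomorphism `g` preserving the measures in `K` such
that `1_U - 1_V` is a coboundary `w ∘ g - w`, with `w` continuous, whenever `U` and `V` are
`K`-equivalent. Indeed a `g`-invariant measure `ν` then gives equal mass to `K`-equivalent sets. If
`ν` were not in `K`, it could be separated from `K` by the integral of an integer function, and the
division lemma would turn this function and the separating constant into clopen sets violating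
goodness (`IsGoodSystem.mem_of_mem_respecting`). Moreover `g` is minimal, since an orbit avoiding a
clopen set would visit any set equivalent to a part of it only boundedly often; and the matching
lemma gives elements of `[[g]]` that map `U` onto `V`, which implies saturation.

Such a `g` is the limit of homeomorphisms `g_n` with finite cycles and clopen bases `B_n`
(`IsStage`), where `g_{n + 1}` differs from `g_n` only at points that `g_n` sends to `B_n`. There is
one operation (`IsGoodSystem.exists_merge`): two disjoint `K`-equivalent subsets `C`, `D` of the
base are exchanged by an involution preserving `K`, which is obtained by back-and-forth
(`IsGoodSystem.exists_swap`), and composing with it joins the cycles starting in `C` to those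
starting in `D`. Let `n(x)` be the sum of `1_U - 1_V` along the cycle of `x`. If its largest value
`b` is at least as large as the largest value of `-n`, then `{n = b}` has at most the mass of
`{n < 0}`, because `n` has integral zero; merging the former with a part of the latter removes the
value `b`. After finitely many merges `n` vanishes (`IsGoodSystem.exists_balance`). Then
`1_U - 1_V = w ∘ g_n - w` with `w = 0` on `B_n`, an identity that survives all later changes.
Merging also allows the bases and their preimages to shrink to points
(`IsGoodSystem.exists_shrink`), so that the limit is a homeomorphism.
-/

set_option linter.unusedSectionVars false

namespace CantorDynamics

/-! ### Clopen sets and good systems of measures -/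

section Basic

variable {X : Type*} [TopologicalSpace X] [MeasurableSpace X]

/-- The definition of a dynamical simplex without convexity and approximate divisibility. -/
structure IsGoodSystem (K : Set (ProbabilityMeasure X)) [OpensMeasurableSpace X] : Prop where
  nonempty : K.Nonempty
  isCompact : IsCompact K
  atomless : ∀ μ ∈ K, ∀ x : X, (μ : Measure X) {x} = 0
  fullSupport : ∀ μ ∈ K, (μ : Measure X).IsOpenPosMeasure
  good : IsGood K

/-- Two sets are `K`-equivalent if all measures in `K` give them the same mass. -/
def KEquiv (K : Set (ProbabilityMeasure X)) (U V : Set X) : Prop :=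
  ∀ μ ∈ K, (μ : Measure X).real U = (μ : Measure X).real V

/-- The probability measures that give the same mass to any two `K`-equivalent clopen sets. -/
def respecting (K : Set (ProbabilityMeasure X)) : Set (ProbabilityMeasure X) :=
  {ν | ∀ U V : Set X, IsClopen U → IsClopen V → KEquiv K U V →
    (ν : Measure X).real U = (ν : Measure X).real V}

variable {K : Set (ProbabilityMeasure X)} {U V W : Set X}

lemma KEquiv.refl (U : Set X) : KEquiv K U U := fun _ _ => rfl
lemma KEquiv.symm (h : KEquiv K U V) : KEquiv K V U := fun μ hμ => (h μ hμ).symm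
lemma KEquiv.trans (h : KEquiv K U V) (h' : KEquiv K V W) : KEquiv K U W :=
  fun μ hμ => (h μ hμ).trans (h' μ hμ)

lemma subset_respecting (K : Set (ProbabilityMeasure X)) : K ⊆ respecting K :=
  fun μ hμ _ _ _ _ h => h μ hμ

variable [BorelSpace X]

lemma KEquiv.diff {U' V' : Set X} (h : KEquiv K U V) (h' : KEquiv K U' V') (hU : U' ⊆ U)
    (hV : V' ⊆ V) (hU' : IsClopen U') (hV' : IsClopen V') : KEquiv K (U \ U') (V \ V') := by
  intro μ hμ
  rw [measureReal_sdiff hU hU'.isOpen.measurableSet, measureReal_sdiff hV hV'.isOpen.measurableSet,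
    h μ hμ, h' μ hμ]

lemma measureReal_pos_of_isClopen {μ : ProbabilityMeasure X}
    (h : (μ : Measure X).IsOpenPosMeasure) (hU : IsClopen U) (hne : U.Nonempty) :
    0 < (μ : Measure X).real U := by
  rw [measureReal_def]
  exact ENNReal.toReal_pos (hU.isOpen.measure_pos _ hne).ne' (measure_ne_top _ _)

lemma IsGood.exists_subset (hg : IsGood K) (hU : IsClopen U) (hV : IsClopen V)
    (h : ∀ μ ∈ K, (μ : Measure X).real U < (μ : Measure X).real V) :
    ∃ C, IsClopen C ∧ C ⊆ V ∧ KEquiv K C U := by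
  obtain ⟨C, hC, hCV, hCU⟩ := hg U V hU hV (fun μ hμ => by
    have := h μ hμ
    simpa using this)
  refine ⟨C, hC, hCV, fun μ hμ => ?_⟩
  simp [hCU μ hμ]

/-- Clopen subsets can be transported along `K`-equivalence. -/
lemma IsGoodSystem.exists_transport (hK : IsGoodSystem K) (hU : IsClopen U) (hV : IsClopen V)
    (h : KEquiv K U V) {A : Set X} (hA : IsClopen A) (hAU : A ⊆ U) :
    ∃ C, IsClopen C ∧ C ⊆ V ∧ KEquiv K C A := by
  rcases (U \ A).eq_empty_or_nonempty with he | hne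
  · have : A = U := hAU.antisymm (sdiff_eq_empty.1 he)
    exact ⟨V, hV, le_rfl, this ▸ h.symm⟩
  · refine hK.good.exists_subset hA hV fun μ hμ => ?_
    have := measureReal_pos_of_isClopen (hK.fullSupport μ hμ) (hU.diff hA) hne
    rw [measureReal_sdiff hAU hA.isOpen.measurableSet] at this
    rw [← h μ hμ]; linarith

variable [CompactSpace X] [TopologicalSpace.MetrizableSpace X]

lemma continuous_measureReal_of_isClopen (hU : IsClopen U) :
    Continuous fun μ : ProbabilityMeasure X => (μ : Measure X).real U := by
  rw [continuous_iff_continuousAt]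
  intro μ
  have := ProbabilityMeasure.tendsto_measure_of_isClopen_of_tendsto (μs := id) (μ := μ)
    (L := 𝓝 μ) Filter.tendsto_id hU
  have h2 := (NNReal.continuous_coe.tendsto _).comp this
  simpa [ContinuousAt, Function.comp_def] using h2

lemma IsGoodSystem.exists_pos_le (hK : IsGoodSystem K) (hU : IsClopen U) (hne : U.Nonempty) :
    ∃ ε : ℝ, 0 < ε ∧ ∀ μ ∈ K, ε ≤ (μ : Measure X).real U := by
  obtain ⟨μ₀, h₀, hmin⟩ := hK.isCompact.exists_isMinOn hK.nonempty
    (continuous_measureReal_of_isClopen hU).continuousOn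
  exact ⟨_, measureReal_pos_of_isClopen (hK.fullSupport μ₀ h₀) hU hne, fun μ hμ => hmin hμ⟩

variable [TotallyDisconnectedSpace X]

/-- Two probability measures that agree on clopen sets are equal. -/
lemma ext_of_isClopen {μ ν : Measure X} [IsFiniteMeasure μ]
    (h : ∀ U : Set X, IsClopen U → μ U = ν U) : μ = ν := by
  have hb := loc_compact_Haus_tot_disc_of_zero_dim (H := X)
  have : SecondCountableTopology X := by
    let := TopologicalSpace.metrizableSpaceMetric X
    infer_instance
  refine ext_of_generate_finite {s : Set X | IsClopen s} ?_ ?_ h (h _ isClopen_univ)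
  · rw [BorelSpace.measurable_eq (α := X)]
    exact hb.borel_eq_generateFrom
  · intro s hs t ht _
    exact IsClopen.inter hs ht

lemma exists_isClopen_mem_subset {O : Set X} (hO : IsOpen O) {x : X} (hx : x ∈ O) :
    ∃ V : Set X, IsClopen V ∧ x ∈ V ∧ V ⊆ O :=
  loc_compact_Haus_tot_disc_of_zero_dim.exists_subset_of_mem_open hx hO

lemma IsGoodSystem.exists_small_nhd (hK : IsGoodSystem K) {ε : ℝ} (hε : 0 < ε) (x : X) :
    ∃ V : Set X, IsClopen V ∧ x ∈ V ∧ ∀ μ ∈ K, (μ : Measure X).real V < ε := by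
  have : Nonempty {V : Set X // IsClopen V ∧ x ∈ V} := ⟨⟨univ, isClopen_univ, mem_univ x⟩⟩
  suffices h : ∃ V : {V : Set X // IsClopen V ∧ x ∈ V},
      K ⊆ {μ : ProbabilityMeasure X | (μ : Measure X).real V < ε} by
    obtain ⟨⟨V, hV, hxV⟩, hVK⟩ := h
    exact ⟨V, hV, hxV, hVK⟩
  refine hK.isCompact.elim_directed_cover _
    (fun V => isOpen_lt (continuous_measureReal_of_isClopen V.2.1) continuous_const) ?_ ?_
  · intro μ hμ
    obtain ⟨O, hxO, hO, hlt⟩ := Set.exists_isOpen_lt_of_lt ({x} : Set X) (μ := (μ : Measure X))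
      (ENNReal.ofReal ε) (by rw [hK.atomless μ hμ x]; simpa using hε)
    obtain ⟨V, hV, hxV, hVO⟩ := exists_isClopen_mem_subset hO (singleton_subset_iff.1 hxO)
    refine mem_iUnion.2 ⟨⟨V, hV, hxV⟩, ?_⟩
    have h1 := (measure_mono hVO).trans_lt hlt
    rw [mem_ofPred_eq, measureReal_def]
    exact (ENNReal.lt_ofReal_iff_toReal_lt (measure_ne_top _ _)).1 h1
  · rintro ⟨V, hV, hxV⟩ ⟨W, hW, hxW⟩
    refine ⟨⟨V ∩ W, hV.inter hW, hxV, hxW⟩, ?_, ?_⟩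
    · intro μ hμ
      exact (measureReal_mono inter_subset_left).trans_lt hμ
    · intro μ hμ
      exact (measureReal_mono inter_subset_right).trans_lt hμ

lemma IsGoodSystem.exists_small_subset (hK : IsGoodSystem K) {ε : ℝ} (hε : 0 < ε)
    (hU : IsClopen U) (hne : U.Nonempty) :
    ∃ V : Set X, IsClopen V ∧ V ⊆ U ∧ V.Nonempty ∧ ∀ μ ∈ K, (μ : Measure X).real V < ε := by
  obtain ⟨x, hx⟩ := hne
  obtain ⟨V, hV, hxV, h⟩ := hK.exists_small_nhd hε x
  exact ⟨V ∩ U, hV.inter hU, inter_subset_right, ⟨x, hxV, hx⟩,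
    fun μ hμ => (measureReal_mono inter_subset_left).trans_lt (h μ hμ)⟩

/-- Points have clopen neighbourhoods of mass less than that of a given nonempty clopen set. -/
lemma IsGoodSystem.exists_nhd_lt (hK : IsGoodSystem K) {E : Set X} (hE : IsClopen E)
    (hne : E.Nonempty) (x : X) :
    ∃ V : Set X, IsClopen V ∧ x ∈ V ∧
      ∀ μ ∈ K, (μ : Measure X).real V < (μ : Measure X).real E := by
  obtain ⟨ε, hε, h⟩ := hK.exists_pos_le hE hne
  obtain ⟨V, hV, hx, hlt⟩ := hK.exists_small_nhd hε x
  exact ⟨V, hV, hx, fun μ hμ => (hlt μ hμ).trans_le (h μ hμ)⟩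

end Basic

/-! ### Measure preserving homeomorphisms -/

section Homeo

variable {X : Type*} [TopologicalSpace X] [MeasurableSpace X] [BorelSpace X]

lemma measure_preimage_of_mem_invariantMeasures {g : X ≃ₜ X} {μ : ProbabilityMeasure X}
    (h : μ ∈ invariantMeasures g) (A : Set X) : (μ : Measure X) (g ⁻¹' A) = (μ : Measure X) A := by
  have h' : (μ : Measure X).map g = (μ : Measure X) := h
  have := g.toMeasurableEquiv.map_apply (μ := (μ : Measure X)) A
  conv_rhs => rw [← h']
  exact this.symm

lemma measure_image_of_mem_invariantMeasures {g : X ≃ₜ X} {μ : ProbabilityMeasure X}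
    (h : μ ∈ invariantMeasures g) (A : Set X) : (μ : Measure X) (g '' A) = (μ : Measure X) A := by
  rw [← measure_preimage_of_mem_invariantMeasures h (g '' A), g.injective.preimage_image]

lemma mem_invariantMeasures_of_measure_preimage {g : X ≃ₜ X} {μ : ProbabilityMeasure X}
    (h : ∀ A, MeasurableSet A → (μ : Measure X) (g ⁻¹' A) = (μ : Measure X) A) :
    μ ∈ invariantMeasures g := by
  refine Measure.ext fun A hA => ?_
  rw [Measure.map_apply g.continuous.measurable hA, h A hA]

lemma mem_invariantMeasures_one (μ : ProbabilityMeasure X) : μ ∈ invariantMeasures (1 : X ≃ₜ X) :=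
  mem_invariantMeasures_of_measure_preimage fun _ _ => rfl

lemma mem_invariantMeasures_mul {g h : X ≃ₜ X} {μ : ProbabilityMeasure X}
    (hg : μ ∈ invariantMeasures g) (hh : μ ∈ invariantMeasures h) :
    μ ∈ invariantMeasures (g * h) :=
  mem_invariantMeasures_of_measure_preimage fun A _ => by
    rw [← measure_preimage_of_mem_invariantMeasures hg A,
      ← measure_preimage_of_mem_invariantMeasures hh (g ⁻¹' A)]
    rfl

lemma mem_invariantMeasures_inv {g : X ≃ₜ X} {μ : ProbabilityMeasure X}
    (hg : μ ∈ invariantMeasures g) : μ ∈ invariantMeasures g⁻¹ :=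
  mem_invariantMeasures_of_measure_preimage fun A _ => by
    have : ⇑(g⁻¹) ⁻¹' A = g '' A := (g.image_eq_preimage_symm A).symm
    rw [this, measure_image_of_mem_invariantMeasures hg]

lemma mem_invariantMeasures_zpow {g : X ≃ₜ X} {μ : ProbabilityMeasure X}
    (hg : μ ∈ invariantMeasures g) (n : ℤ) : μ ∈ invariantMeasures (g ^ n) := by
  have hpos : ∀ n : ℕ, μ ∈ invariantMeasures (g ^ n) := by
    intro n
    induction n with
    | zero => simpa using mem_invariantMeasures_one μ
    | succ n ih => rw [pow_succ]; exact mem_invariantMeasures_mul ih hg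
  cases n with
  | ofNat n => simpa using hpos n
  | negSucc n => rw [zpow_negSucc]; exact mem_invariantMeasures_inv (hpos _)

variable [T2Space X]

/-- A homeomorphism that agrees at each point with one of countably many measure preserving
homeomorphisms is measure preserving. -/
lemma mem_invariantMeasures_of_forall_exists_eq {k : X ≃ₜ X} {μ : ProbabilityMeasure X}
    {ι : Type*} [Countable ι] (g : ι → X ≃ₜ X) (hg : ∀ n, μ ∈ invariantMeasures (g n))
    (h : ∀ x, ∃ n, k x = g n x) : μ ∈ invariantMeasures k := by
  classical
  rcases isEmpty_or_nonempty X with hX | ⟨⟨x₀⟩⟩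
  · exact mem_invariantMeasures_of_measure_preimage fun A _ => by simp [Set.eq_empty_of_isEmpty]
  have : Nonempty ι := ⟨(h x₀).choose⟩
  obtain ⟨f, hf⟩ := exists_surjective_nat ι
  set E : ℕ → Set X := fun n => {x | k x = g (f n) x} with hE
  have hEm : ∀ n, MeasurableSet (E n) := fun n =>
    (isClosed_eq k.continuous (g (f n)).continuous).measurableSet
  have hEu : ⋃ n, disjointed E n = univ := by
    rw [iUnion_disjointed, eq_univ_iff_forall]
    intro x
    obtain ⟨n, hn⟩ := h x
    obtain ⟨m, rfl⟩ := hf n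
    exact mem_iUnion.2 ⟨m, hn⟩
  have hFm : ∀ n, MeasurableSet (disjointed E n) := fun n => MeasurableSet.disjointed hEm n
  have hFE : ∀ n, ∀ x ∈ disjointed E n, k x = g (f n) x := fun n x hx => disjointed_subset E n hx
  refine mem_invariantMeasures_of_measure_preimage fun A hA => ?_
  have h1 : k ⁻¹' A = ⋃ n, disjointed E n ∩ k ⁻¹' A := by
    rw [← iUnion_inter, hEu, univ_inter]
  have h2 : A = ⋃ n, k '' (disjointed E n ∩ k ⁻¹' A) := by
    rw [← image_iUnion, ← h1, image_preimage_eq _ k.surjective]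
  have hd : Pairwise (Function.onFun Disjoint fun n => disjointed E n ∩ k ⁻¹' A) := fun i j hij =>
    ((disjoint_disjointed E) hij).mono inter_subset_left inter_subset_left
  have hm : ∀ n, MeasurableSet (disjointed E n ∩ k ⁻¹' A) := fun n =>
    (hFm n).inter (k.continuous.measurable hA)
  calc (μ : Measure X) (k ⁻¹' A) = ∑' n, (μ : Measure X) (disjointed E n ∩ k ⁻¹' A) := by
        conv_lhs => rw [h1]
        exact measure_iUnion hd hm
    _ = ∑' n, (μ : Measure X) (k '' (disjointed E n ∩ k ⁻¹' A)) := by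
        congr 1 with n
        rw [← measure_image_of_mem_invariantMeasures (hg (f n))]
        congr 1
        exact image_congr fun x hx => (hFE n x hx.1).symm
    _ = (μ : Measure X) A := by
        conv_rhs => rw [h2]
        refine (measure_iUnion ?_ ?_).symm
        · exact fun i j hij => (disjoint_image_iff k.injective).2 (hd hij)
        · exact fun n => (k.toMeasurableEquiv.measurableSet_image).2 (hm n)

end Homeo

/-! ### Back-and-forth -/

section BackAndForth

variable {X : Type*} [TopologicalSpace X] [MeasurableSpace X] [BorelSpace X] [CompactSpace X]
  [TopologicalSpace.MetrizableSpace X] [TotallyDisconnectedSpace X]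
  {K : Set (ProbabilityMeasure X)}

variable (X) in
lemma exists_enumeration_isClopen :
    ∃ W : ℕ → Set X, (∀ n, IsClopen (W n)) ∧ ∀ U, IsClopen U → ∃ n, W n = U := by
  have : SecondCountableTopology X := by
    let := TopologicalSpace.metrizableSpaceMetric X
    infer_instance
  have : Countable (TopologicalSpace.Clopens X) :=
    TopologicalSpace.Clopens.countable_iff_secondCountable.2 this
  obtain ⟨f, hf⟩ := exists_surjective_nat (TopologicalSpace.Clopens X)
  refine ⟨fun n => f n, fun n => (f n).isClopen, fun U hU => ?_⟩
  obtain ⟨n, hn⟩ := hf ⟨U, hU⟩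
  exact ⟨n, by simp [hn]⟩

lemma isClopen_preimage_discrete {Y : Type*} [TopologicalSpace Y] [DiscreteTopology Y] {a : X → Y}
    (ha : Continuous a) (S : Set Y) : IsClopen (a ⁻¹' S) :=
  (isClopen_discrete S).preimage ha

/-- Labellings `a` and `b` of `X` are matched if fibres with equal labels are `K`-equivalent. -/
def Matched (K : Set (ProbabilityMeasure X)) (a b : X → ℕ) : Prop :=
  Continuous a ∧ Continuous b ∧ ∀ i, KEquiv K (a ⁻¹' {i}) (b ⁻¹' {i})

lemma Matched.symm {a b : X → ℕ} (h : Matched K a b) : Matched K b a :=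
  ⟨h.2.1, h.1, fun i => (h.2.2 i).symm⟩

lemma Matched.measure_preimage {a b : X → ℕ} (h : Matched K a b) {μ : ProbabilityMeasure X}
    (hμ : μ ∈ K) (S : Set ℕ) : (μ : Measure X) (a ⁻¹' S) = (μ : Measure X) (b ⁻¹' S) := by
  have : (μ : Measure X).map a = (μ : Measure X).map b := by
    refine Measure.ext_of_singleton fun i => ?_
    rw [Measure.map_apply h.1.measurable (.singleton i),
      Measure.map_apply h.2.1.measurable (.singleton i)]
    exact (ENNReal.toReal_eq_toReal_iff' (measure_ne_top _ _) (measure_ne_top _ _)).1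
      (h.2.2 i μ hμ)
  rw [← Measure.map_apply h.1.measurable .of_discrete,
    ← Measure.map_apply h.2.1.measurable .of_discrete, this]

/-- One half of a back-and-forth step: the label `2 * a + 1` is given to the points of `A`. -/
lemma IsGoodSystem.exists_refine (hK : IsGoodSystem K) {a b : X → ℕ} (h : Matched K a b)
    {A : Set X} (hA : IsClopen A) :
    ∃ a' b' : X → ℕ, Matched K a' b' ∧ (∀ x, a x = a' x / 2) ∧ (∀ x, b x = b' x / 2) ∧
      A = a' ⁻¹' {i | i % 2 = 1} := by
  classical
  have hca : ∀ i, IsClopen (a ⁻¹' {i}) := fun i => isClopen_preimage_discrete h.1 _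
  have hcb : ∀ i, IsClopen (b ⁻¹' {i}) := fun i => isClopen_preimage_discrete h.2.1 _
  choose C hC hCb hCA using fun i => hK.exists_transport (hca i) (hcb i) (h.2.2 i)
    ((hca i).inter hA) inter_subset_left
  have ha2 : ∀ x, (2 * a x + if x ∈ A then 1 else 0) / 2 = a x := fun x => by split_ifs <;> omega
  have hb2 : ∀ x, (2 * b x + if x ∈ C (b x) then 1 else 0) / 2 = b x :=
    fun x => by split_ifs <;> omega
  have fa : ∀ i, (fun x => 2 * a x + if x ∈ A then 1 else 0) ⁻¹' {i} =
      if i % 2 = 1 then a ⁻¹' {i / 2} ∩ A else a ⁻¹' {i / 2} \ (a ⁻¹' {i / 2} ∩ A) := by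
    intro i; ext x
    split_ifs with hi <;> simp only [mem_preimage, mem_singleton_iff, mem_inter_iff, mem_sdiff] <;>
      split_ifs with hx <;> simp [hx] <;> omega
  have fb : ∀ i, (fun x => 2 * b x + if x ∈ C (b x) then 1 else 0) ⁻¹' {i} =
      if i % 2 = 1 then C (i / 2) else b ⁻¹' {i / 2} \ C (i / 2) := by
    intro i; ext x
    have key : x ∈ C (i / 2) → b x = i / 2 := fun hx => hCb _ hx
    split_ifs with hi
    · simp only [mem_preimage, mem_singleton_iff]
      constructor
      · intro hx
        split_ifs at hx with h1
        · have : b x = i / 2 := by omega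
          rwa [← this]
        · omega
      · intro hx
        have h1 := key hx
        rw [if_pos (by rwa [h1])]; omega
    · simp only [mem_preimage, mem_singleton_iff, mem_sdiff]
      constructor
      · intro hx
        split_ifs at hx with h1
        · omega
        · have : b x = i / 2 := by omega
          exact ⟨this, by rwa [← this]⟩
      · rintro ⟨h1, h2⟩
        rw [if_neg (by rwa [h1])]; omega
  refine ⟨_, _, ⟨continuous_discrete_rng.2 fun i => ?_,
    continuous_discrete_rng.2 fun i => ?_, fun i => ?_⟩,
    fun x => (ha2 x).symm, fun x => (hb2 x).symm, ?_⟩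
  · rw [fa]; split_ifs
    · exact ((hca _).inter hA).isOpen
    · exact ((hca _).diff ((hca _).inter hA)).isOpen
  · rw [fb]; split_ifs
    · exact (hC _).isOpen
    · exact ((hcb _).diff (hC _)).isOpen
  · rw [fa, fb]; split_ifs
    · exact (hCA _).symm
    · exact (h.2.2 _).diff (hCA _).symm inter_subset_left (hCb _) ((hca _).inter hA) (hC _)
  · ext x
    simp only [mem_preimage, mem_ofPred_eq]
    split_ifs with hx <;> simp [hx]

lemma IsGoodSystem.exists_refine_both (hK : IsGoodSystem K) {a b : X → ℕ} (h : Matched K a b)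
    {A : Set X} (hA : IsClopen A) :
    ∃ a' b' : X → ℕ, Matched K a' b' ∧ (∀ x, a x = a' x / 4) ∧ (∀ x, b x = b' x / 4) ∧
      (∃ S, A = a' ⁻¹' S) ∧ ∃ S, A = b' ⁻¹' S := by
  obtain ⟨a₁, b₁, h₁, ha₁, hb₁, hA₁⟩ := hK.exists_refine h hA
  obtain ⟨b₂, a₂, h₂, hb₂, ha₂, hA₂⟩ := hK.exists_refine h₁.symm hA
  refine ⟨a₂, b₂, h₂.symm, fun x => ?_, fun x => ?_, ⟨{i | i / 2 % 2 = 1}, ?_⟩, ⟨_, hA₂⟩⟩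
  · rw [ha₁, ha₂, Nat.div_div_eq_div_mul]
  · rw [hb₁, hb₂, Nat.div_div_eq_div_mul]
  · rw [hA₁]; ext x; simp [ha₂]

/-- Back-and-forth: matched labellings are conjugate by a homeomorphism preserving all of `K`. -/
theorem IsGoodSystem.exists_homeo_of_matched (hK : IsGoodSystem K) {a b : X → ℕ}
    (h : Matched K a b) :
    ∃ g : X ≃ₜ X, K ⊆ invariantMeasures g ∧ ∀ x, b (g x) = a x := by
  obtain ⟨W, hW, hWs⟩ := exists_enumeration_isClopen X
  choose A' B' hM hA hB hSA hSB using fun (p : {p : (X → ℕ) × (X → ℕ) // Matched K p.1 p.2})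
    (n : ℕ) => hK.exists_refine_both p.2 (hW n)
  let s : ℕ → {p : (X → ℕ) × (X → ℕ) // Matched K p.1 p.2} := fun n =>
    Nat.rec ⟨(a, b), h⟩ (fun n p => ⟨(A' p n, B' p n), hM p n⟩) n
  let α : ℕ → X → ℕ := fun n => (s n).1.1
  let β : ℕ → X → ℕ := fun n => (s n).1.2
  have hαβ : ∀ n, Matched K (α n) (β n) := fun n => (s n).2
  have hα : ∀ n x, α n x = α (n + 1) x / 4 := fun n => hA (s n) n
  have hβ : ∀ n x, β n x = β (n + 1) x / 4 := fun n => hB (s n) n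
  have hWα : ∀ n, ∃ S, W n = α (n + 1) ⁻¹' S := fun n => hSA (s n) n
  have hWβ : ∀ n, ∃ S, W n = β (n + 1) ⁻¹' S := fun n => hSB (s n) n
  have hα0 : α 0 = a := rfl
  have hβ0 : β 0 = b := rfl
  clear_value α β
  -- the common part: a map intertwining two matched sequences of refining labellings
  have key : ∀ α β : ℕ → X → ℕ, (∀ n, Matched K (α n) (β n)) → (∀ n x, α n x = α (n + 1) x / 4) →
      (∀ n x, β n x = β (n + 1) x / 4) → ∃ f : X → X, ∀ n x, β n (f x) = α n x := by
    intro α β hαβ hα hβ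
    have : ∀ x, ∃ y, ∀ n, β n y = α n x := by
      intro x
      have hne : (⋂ n, β n ⁻¹' {α n x}).Nonempty := by
        refine IsCompact.nonempty_iInter_of_sequence_nonempty_isCompact_isClosed _ ?_ ?_ ?_ ?_
        · intro n y hy
          have : β (n + 1) y = α (n + 1) x := hy
          change β n y = α n x
          rw [hβ, hα, this]
        · intro n
          obtain ⟨μ, hμ⟩ := hK.nonempty
          have h1 := (hαβ n).2.2 (α n x) μ hμ
          have h2 : 0 < (μ : Measure X).real (α n ⁻¹' {α n x}) :=
            measureReal_pos_of_isClopen (hK.fullSupport μ hμ)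
              (isClopen_preimage_discrete (hαβ n).1 _) ⟨x, rfl⟩
          rw [h1] at h2
          exact nonempty_of_measureReal_ne_zero h2.ne'
        · exact (isClopen_preimage_discrete (hαβ 0).2.1 _).isClosed.isCompact
        · exact fun n => (isClopen_preimage_discrete (hαβ n).2.1 _).isClosed
      obtain ⟨y, hy⟩ := hne
      exact ⟨y, fun n => mem_iInter.1 hy n⟩
    choose f hf using this
    exact ⟨f, fun n x => hf x n⟩
  obtain ⟨f, hf⟩ := key α β hαβ hα hβ
  obtain ⟨f', hf'⟩ := key β α (fun n => (hαβ n).symm) hβ hα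
  have sep : ∀ γ : ℕ → X → ℕ, (∀ n, ∃ S, W n = γ (n + 1) ⁻¹' S) → ∀ x y, (∀ n, γ n x = γ n y) →
      x = y := by
    intro γ hγ x y hxy
    by_contra hne
    obtain ⟨V, hV, hx, hVy⟩ := exists_isClopen_mem_subset (isOpen_compl_singleton (x := y)) hne
    obtain ⟨n, rfl⟩ := hWs V hV
    obtain ⟨S, hS⟩ := hγ n
    refine hVy (?_ : y ∈ W n) rfl
    rw [hS] at hx ⊢
    simpa [← hxy] using hx
  have hcont : Continuous f := by
    refine loc_compact_Haus_tot_disc_of_zero_dim.continuous_iff.2 fun V hV => ?_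
    obtain ⟨n, rfl⟩ := hWs V hV
    obtain ⟨S, hS⟩ := hWβ n
    have : f ⁻¹' W n = α (n + 1) ⁻¹' S := by ext x; simp [hS, hf]
    rw [this]
    exact (isClopen_preimage_discrete (hαβ _).1 _).isOpen
  let e : X ≃ X := ⟨f, f', fun x => sep α hWα _ _ fun n => by rw [hf', hf],
    fun x => sep β hWβ _ _ fun n => by rw [hf, hf']⟩
  refine ⟨(show Continuous e from hcont).homeoOfEquivCompactToT2, fun μ hμ => ?_, fun x => ?_⟩
  · refine ext_of_isClopen fun V hV => ?_
    refine (Measure.map_apply hcont.measurable hV.isOpen.measurableSet).trans ?_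
    obtain ⟨n, rfl⟩ := hWs V hV
    obtain ⟨S, hS⟩ := hWβ n
    have : f ⁻¹' W n = α (n + 1) ⁻¹' S := by ext x; simp [hS, hf]
    rw [this, hS, (hαβ _).measure_preimage hμ]
  · have h0 := hf 0 x
    rwa [hα0, hβ0] at h0

/-- Disjoint `K`-equivalent clopen sets are exchanged by an involution that preserves all measures
in `K` and fixes the other points. -/
theorem IsGoodSystem.exists_swap (hK : IsGoodSystem K) {C D : Set X} (hC : IsClopen C)
    (hD : IsClopen D) (hCD : Disjoint C D) (h : KEquiv K C D) :
    ∃ τ : X ≃ₜ X, K ⊆ invariantMeasures τ ∧ (∀ x, τ (τ x) = x) ∧ (∀ x ∈ C, τ x ∈ D) ∧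
      (∀ x ∈ D, τ x ∈ C) ∧ ∀ x, x ∉ C → x ∉ D → τ x = x := by
  classical
  have hDC : ∀ x ∈ D, x ∉ C := fun x hx hx' => disjoint_left.1 hCD hx' hx
  have lab : ∀ {C D : Set X}, IsClopen C → IsClopen D → Disjoint C D → ∀ i : ℕ,
      (fun x => if x ∈ C then 1 else if x ∈ D then 2 else 0 : X → ℕ) ⁻¹' {i} =
      if i = 1 then C else if i = 2 then D else if i = 0 then (C ∪ D)ᶜ else ∅ := by
    intro C D hC hD hCD i
    ext x
    have := fun h : x ∈ C => disjoint_left.1 hCD h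
    by_cases h1 : x ∈ C <;> by_cases h2 : x ∈ D <;> rcases i with _ | _ | _ | i <;>
      simp_all
  have cont : ∀ {C D : Set X}, IsClopen C → IsClopen D → Disjoint C D →
      Continuous (fun x => if x ∈ C then 1 else if x ∈ D then 2 else 0 : X → ℕ) := by
    intro C D hC hD hCD
    refine continuous_discrete_rng.2 fun i => ?_
    rw [lab hC hD hCD]
    split_ifs
    exacts [hC.isOpen, hD.isOpen, (hC.union hD).compl.isOpen, isOpen_empty]
  obtain ⟨g, hg, hgab⟩ := hK.exists_homeo_of_matched
    (a := fun x => if x ∈ C then 1 else if x ∈ D then 2 else 0)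
    (b := fun x => if x ∈ D then 1 else if x ∈ C then 2 else 0)
    ⟨cont hC hD hCD, cont hD hC hCD.symm, fun i => by
      rw [lab hC hD hCD, lab hD hC hCD.symm]
      split_ifs
      exacts [h, h.symm, by rw [union_comm]; exact .refl _, .refl _]⟩
  have hgC : ∀ x, x ∈ C ↔ g x ∈ D := fun x => by
    have := hgab x
    split_ifs at this <;> simp_all
  have hgD : ∀ x, g⁻¹ x ∈ C ↔ x ∈ D := fun x => by
    rw [hgC]; change g (g.symm x) ∈ D ↔ _; rw [g.apply_symm_apply]
  have hg1 : ∀ x, g⁻¹ (g x) = x := g.symm_apply_apply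
  have hg2 : ∀ x, g (g⁻¹ x) = x := g.apply_symm_apply
  let f : X → X := fun x => if x ∈ C then g x else if x ∈ D then g⁻¹ x else x
  have hff : ∀ x, f (f x) = x := by
    intro x
    simp only [f]
    by_cases h1 : x ∈ C
    · have h2 := (hgC x).1 h1
      simp [h1, h2, hDC _ h2, hg1]
    · by_cases h2 : x ∈ D
      · rw [if_neg h1, if_pos h2, if_pos ((hgD x).2 h2), hg2]
      · simp [h1, h2]
  have hf : Continuous f := by
    refine continuous_if (fun x hx => ?_) g.continuous.continuousOn
      (continuous_if (fun x hx => ?_) (g⁻¹).continuous.continuousOn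
        continuous_id.continuousOn).continuousOn
    · exact absurd hx (by change x ∉ frontier C; simp [hC.frontier_eq])
    · exact absurd hx (by change x ∉ frontier D; simp [hD.frontier_eq])
  let e : X ≃ₜ X := ⟨⟨f, f, hff, hff⟩, hf, hf⟩
  refine ⟨e, fun μ hμ => ?_, hff, fun x hx => ?_, fun x hx => ?_, fun x h1 h2 => ?_⟩
  · refine mem_invariantMeasures_of_forall_exists_eq (fun i : ℤ => g ^ i)
      (fun i => mem_invariantMeasures_zpow (hg hμ) i) fun x => ?_
    change ∃ n : ℤ, f x = _
    simp only [f]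
    split_ifs
    exacts [⟨1, by simp⟩, ⟨-1, by simp⟩, ⟨0, by simp⟩]
  · change f x ∈ D
    simpa [f, hx] using (hgC x).1 hx
  · change f x ∈ C
    simpa [f, hx, hDC x hx] using (hgD x).2 hx
  · change f x = x
    simp [f, h1, h2]

end BackAndForth

/-! ### Parenthesis matching along orbits -/

section Matching

variable {X : Type*} [TopologicalSpace X]

/-- The difference `1_U - 1_V` of indicator functions, with integer values. -/
noncomputable def surplus (U V : Set X) : X → ℤ := U.indicator 1 - V.indicator 1

lemma continuous_surplus {U V : Set X} (hU : IsClopen U) (hV : IsClopen V) :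
    Continuous (surplus U V) :=
  (continuous_const.indicator (f := fun _ => (1 : ℤ)) (by simp [hU.frontier_eq])).sub
    (continuous_const.indicator (f := fun _ => (1 : ℤ)) (by simp [hV.frontier_eq]))

lemma surplus_le_zero {U V : Set X} {x : X} (hx : x ∉ U) : surplus U V x ≤ 0 := by
  by_cases h2 : x ∈ V <;> simp [surplus, hx, h2]

lemma surplus_nonneg {U V : Set X} {x : X} (hx : x ∈ U ∨ x ∉ V) : 0 ≤ surplus U V x := by
  by_cases h1 : x ∈ U <;> by_cases h2 : x ∈ V <;> simp_all [surplus]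

lemma neg_one_le_surplus (U V : Set X) (x : X) : -1 ≤ surplus U V x := by
  by_cases h1 : x ∈ U <;> by_cases h2 : x ∈ V <;> simp [surplus, h1, h2]

lemma continuous_birkhoffSum (g : X ≃ₜ X) {f : X → ℤ} (hf : Continuous f) (n : ℕ) :
    Continuous (birkhoffSum g f n) := by
  unfold birkhoffSum
  exact continuous_finsetSum _ fun i _ => hf.comp (g.continuous.iterate i)

lemma zpow_natCast_apply (g : X ≃ₜ X) (n : ℕ) (x : X) : (g ^ (n : ℤ)) x = g^[n] x := by
  rw [zpow_natCast]
  induction n generalizing x with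
  | zero => rfl
  | succ n ih => rw [pow_succ, Function.iterate_succ_apply]; exact ih (g x)

/-- Parenthesis matching: reading the points of `U` as opening and those of `V` as closing
parentheses, each point of `U` is sent along its orbit to the matching point of `V`. -/
lemma exists_matching (g : X ≃ₜ X) {U V : Set X} (hU : IsClopen U) (hV : IsClopen V)
    (h : ∀ x ∈ U, ∃ m, birkhoffSum g (surplus U V) (m + 1) x ≤ 0) :
    ∃ e : X → ℕ, Continuous e ∧ InjOn (fun x => g^[e x] x) U ∧ MapsTo (fun x => g^[e x] x) U V := by
  classical
  set f := surplus U V with hf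
  have h' : ∀ x, ∃ m, birkhoffSum g f (m + 1) x ≤ 0 := fun x => by
    by_cases hx : x ∈ U
    · exact h x hx
    · exact ⟨0, by simpa using surplus_le_zero hx⟩
  have hpos : ∀ x, ∀ m < Nat.find (h' x), 1 ≤ birkhoffSum g f (m + 1) x := fun x m hm => by
    have := Nat.find_min (h' x) hm
    omega
  have hpos' : ∀ x, ∀ m, 0 < m → m ≤ Nat.find (h' x) → 1 ≤ birkhoffSum g f m x := by
    intro x m h0 hm
    have := hpos x (m - 1) (by omega)
    rwa [Nat.sub_add_cancel h0] at this
  -- at an opening parenthesis outside `V` the partial sums start at `1`, drop by at most one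
  -- in each step, and therefore vanish at the matching time
  have hzero : ∀ x, 0 < Nat.find (h' x) → birkhoffSum g f (Nat.find (h' x) + 1) x = 0 := by
    intro x h0
    have h1 := Nat.find_spec (h' x)
    have h2 := hpos' x _ h0 le_rfl
    rw [birkhoffSum_succ] at h1 ⊢
    have h3 := neg_one_le_surplus U V (g^[Nat.find (h' x)] x)
    rw [← hf] at h3
    omega
  refine ⟨fun x => Nat.find (h' x), ?_, ?_, ?_⟩
  · refine continuous_discrete_rng.2 fun m => ?_
    have : (fun x => Nat.find (h' x)) ⁻¹' {m} =
        {x | birkhoffSum g f (m + 1) x ≤ 0} ∩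
          ⋂ j ∈ Finset.range m, {x | ¬ birkhoffSum g f (j + 1) x ≤ 0} := by
      ext x
      simp [Nat.find_eq_iff]
    rw [this]
    have hc : ∀ m, IsClopen {x | birkhoffSum g f m x ≤ 0} := fun m =>
      (isClopen_discrete (Iic (0 : ℤ))).preimage
        (continuous_birkhoffSum g (continuous_surplus hU hV) m)
    exact (hc _).isOpen.inter (isOpen_biInter_finset fun j _ => (hc _).compl.isOpen)
  · have key : ∀ x ∈ U, ∀ y ∈ U, Nat.find (h' y) ≤ Nat.find (h' x) →
        g^[Nat.find (h' x)] x = g^[Nat.find (h' y)] y → x = y := by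
      intro x hx y hy hle heq
      obtain ⟨p, hp⟩ := Nat.exists_eq_add_of_le hle
      rw [hp, Function.iterate_add_apply] at heq
      have hyx : g^[p] x = y := (g.injective.iterate _) heq
      rcases p.eq_zero_or_pos with rfl | hp0
      · exact hyx
      · exfalso
        have h1 := hzero x (by omega)
        rw [hp, add_comm, ← add_assoc, add_comm 1, add_comm _ p, birkhoffSum_add, hyx] at h1
        have h2 := hpos' x p hp0 (by omega)
        rcases (Nat.find (h' y)).eq_zero_or_pos with h0 | h0
        · rw [h0, zero_add, birkhoffSum_one] at h1
          have := neg_one_le_surplus U V y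
          have h3 : f y ≤ -1 := by omega
          have h4 : 0 ≤ f y := surplus_nonneg (.inl hy)
          omega
        · have := hzero y h0
          omega
    intro x hx y hy heq
    rcases le_total (Nat.find (h' y)) (Nat.find (h' x)) with hle | hle
    · exact key x hx y hy hle heq
    · exact (key y hy x hx hle heq.symm).symm
  · intro x hx
    change g^[Nat.find (h' x)] x ∈ V
    by_contra hV'
    have hnn : 0 ≤ f (g^[Nat.find (h' x)] x) := surplus_nonneg (.inr hV')
    have h1 := Nat.find_spec (h' x)
    rw [birkhoffSum_succ] at h1
    rcases (Nat.find (h' x)).eq_zero_or_pos with h0 | h0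
    · rw [h0] at h1 hV'
      simp only [Function.iterate_zero, id_eq] at h1 hV'
      simp [hf, surplus, hx, hV'] at h1
    · have := hpos' x _ h0 le_rfl
      omega

variable [CompactSpace X] [T2Space X]

lemma isClopen_image_iterate (g : X ≃ₜ X) {U : Set X} (hU : IsClopen U) {e : X → ℕ}
    (he : Continuous e) : IsClopen ((fun x => g^[e x] x) '' U) := by
  have hc : Continuous fun x => g^[e x] x := by
    have : Continuous fun p : ℕ × X => g^[p.1] p.2 :=
      continuous_prod_of_discrete_left.2 fun n => g.continuous.iterate n
    exact this.comp (he.prodMk continuous_id)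
  refine ⟨(hU.isClosed.isCompact.image hc).isClosed, ?_⟩
  have : (fun x => g^[e x] x) '' U = ⋃ n : ℕ, (g ^ (n : ℤ)) '' (U ∩ e ⁻¹' {n}) := by
    ext y
    simp only [mem_image, mem_iUnion, mem_inter_iff, mem_preimage, mem_singleton_iff,
      zpow_natCast_apply]
    constructor
    · rintro ⟨x, hx, rfl⟩
      exact ⟨e x, x, ⟨hx, rfl⟩, rfl⟩
    · rintro ⟨n, x, ⟨hx, rfl⟩, rfl⟩
      exact ⟨x, hx, rfl⟩
  rw [this]
  exact isOpen_iUnion fun n => (g ^ (n : ℤ)).isOpenMap _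
    (hU.isOpen.inter (isOpen_discrete _ |>.preimage he))

variable [MeasurableSpace X] [BorelSpace X]

lemma measure_image_iterate {g : X ≃ₜ X} {U : Set X} (hU : IsClopen U) {e : X → ℕ}
    (he : Continuous e) (hinj : InjOn (fun x => g^[e x] x) U) {μ : ProbabilityMeasure X}
    (hμ : μ ∈ invariantMeasures g) :
    (μ : Measure X) ((fun x => g^[e x] x) '' U) = (μ : Measure X) U := by
  have hu : (⋃ n, U ∩ e ⁻¹' {n}) = U := by
    ext x; simp
  have hm : ∀ n, IsClopen (U ∩ e ⁻¹' {n}) := fun n =>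
    hU.inter ((isClopen_discrete _).preimage he)
  have hd : Pairwise (Function.onFun Disjoint fun n => U ∩ e ⁻¹' {n}) := by
    intro i j hij
    refine disjoint_left.2 fun x hx hx' => hij ?_
    exact hx.2.symm.trans hx'.2
  have him : ∀ n, (fun x => g^[e x] x) '' (U ∩ e ⁻¹' {n}) = (g ^ (n : ℤ)) '' (U ∩ e ⁻¹' {n}) := by
    intro n
    refine image_congr fun x hx => ?_
    rw [zpow_natCast_apply, show e x = n from hx.2]
  calc (μ : Measure X) ((fun x => g^[e x] x) '' U)
      = (μ : Measure X) (⋃ n, (fun x => g^[e x] x) '' (U ∩ e ⁻¹' {n})) := by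
        rw [← image_iUnion, hu]
    _ = ∑' n, (μ : Measure X) ((fun x => g^[e x] x) '' (U ∩ e ⁻¹' {n})) := by
        refine measure_iUnion ?_ ?_
        · intro i j hij
          refine disjoint_left.2 ?_
          rintro _ ⟨x, hx, rfl⟩ ⟨y, hy, hxy⟩
          rw [hinj hy.1 hx.1 hxy] at hy
          exact disjoint_left.1 (hd hij) hx hy
        · intro n
          rw [him]
          exact ((g ^ (n : ℤ)).toMeasurableEquiv.measurableSet_image).2 (hm n).isOpen.measurableSet
    _ = ∑' n, (μ : Measure X) (U ∩ e ⁻¹' {n}) := by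
        congr 1 with n
        rw [him, measure_image_of_mem_invariantMeasures (mem_invariantMeasures_zpow hμ _)]
    _ = (μ : Measure X) U := by
        rw [← measure_iUnion hd fun n => (hm n).isOpen.measurableSet, hu]

end Matching

/-! ### Integrals of continuous integer functions -/

section Integrals

variable {X : Type*} [TopologicalSpace X] [CompactSpace X] [MeasurableSpace X] [BorelSpace X]

lemma integrable_intCast {f : X → ℤ} (hf : Continuous f) (μ : Measure X) [IsFiniteMeasure μ] :
    Integrable (fun x => (f x : ℝ)) μ := by
  have hc : Continuous fun x => (f x : ℝ) := continuous_of_discreteTopology.comp hf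
  obtain ⟨C, hC⟩ := (isCompact_range hc).isBounded.exists_norm_le
  refine Integrable.of_bound (C := C) ?_ (.of_forall fun x => hC _ (mem_range_self x))
  exact (Measurable.of_discrete (f := fun n : ℤ => (n : ℝ))).comp hf.measurable
    |>.aestronglyMeasurable

lemma integral_surplus {U V : Set X} (hU : IsClopen U) (hV : IsClopen V) (μ : Measure X)
    [IsFiniteMeasure μ] : ∫ x, (surplus U V x : ℝ) ∂μ = μ.real U - μ.real V := by
  have hind : ∀ {U : Set X}, IsClopen U →
      Integrable (U.indicator (fun _ => (1 : ℝ))) μ ∧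
        ∫ x, U.indicator (fun _ => (1 : ℝ)) x ∂μ = μ.real U := fun {U} hU =>
    ⟨(integrable_const _).indicator hU.isOpen.measurableSet,
      by rw [integral_indicator_const _ hU.isOpen.measurableSet]; simp⟩
  have : ∀ x, (surplus U V x : ℝ) =
      U.indicator (fun _ => (1 : ℝ)) x - V.indicator (fun _ => (1 : ℝ)) x := fun x => by
    by_cases h1 : x ∈ U <;> by_cases h2 : x ∈ V <;> simp [surplus, h1, h2]
  simp only [this]
  rw [integral_sub (hind hU).1 (hind hV).1, (hind hU).2, (hind hV).2]

lemma integral_comp_of_mem_invariantMeasures {g : X ≃ₜ X} {μ : ProbabilityMeasure X}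
    (h : μ ∈ invariantMeasures g) (f : X → ℝ) :
    ∫ x, f (g x) ∂(μ : Measure X) = ∫ x, f x ∂(μ : Measure X) := by
  have h' : (μ : Measure X).map g = (μ : Measure X) := h
  conv_rhs => rw [← h']
  exact (integral_map_equiv g.toMeasurableEquiv f).symm

end Integrals

/-! ### Invariant measures of a minimal homeomorphism -/

section Forward

variable {X : Type*} [TopologicalSpace X] [CompactSpace X]
  [TopologicalSpace.MetrizableSpace X] [MeasurableSpace X] [BorelSpace X]

/-- The uniform probability measure on the orbit segment `x, g x, ..., g ^ n x`. -/
noncomputable def orbitMeasure (g : X ≃ₜ X) (x : X) (n : ℕ) : ProbabilityMeasure X :=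
  ⟨((n : ENNReal) + 1)⁻¹ • ∑ i ∈ Finset.range (n + 1), Measure.dirac (g^[i] x), ⟨by
    have h1 : ((n : ENNReal) + 1) ≠ 0 := by simp
    have h2 : ((n : ENNReal) + 1) ≠ ⊤ := by simp
    simp [ENNReal.inv_mul_cancel h1 h2]⟩⟩

lemma integral_orbitMeasure (g : X ≃ₜ X) (x : X) (n : ℕ) {f : X → ℤ} (hf : Continuous f) :
    ∫ y, (f y : ℝ) ∂(orbitMeasure g x n : Measure X) =
      ((n : ℝ) + 1)⁻¹ * (birkhoffSum g f (n + 1) x : ℤ) := by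
  change ∫ y, (f y : ℝ) ∂(((n : ENNReal) + 1)⁻¹ •
    ∑ i ∈ Finset.range (n + 1), Measure.dirac (g^[i] x)) = _
  rw [integral_smul_measure, integral_finsetSum_measure]
  · simp only [integral_dirac, birkhoffSum, Int.cast_sum, smul_eq_mul]
    congr 1
    rw [ENNReal.toReal_inv, ENNReal.toReal_add (by simp) (by simp)]
    simp
  · intro i _
    exact integrable_intCast hf _

variable [TotallyDisconnectedSpace X]

/-- Krylov–Bogoliubov: a limit of uniform measures on orbit segments of `x` is invariant, and it
gives nonnegative integral to functions with nonnegative Birkhoff sums at `x`. -/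
lemma exists_invariantMeasure (g : X ≃ₜ X) (x : X) :
    ∃ μ ∈ invariantMeasures g, ∀ f : X → ℤ, Continuous f → (∀ n, 0 ≤ birkhoffSum g f n x) →
      0 ≤ ∫ y, (f y : ℝ) ∂(μ : Measure X) := by
  let F : Ultrafilter (ProbabilityMeasure X) := (Filter.hyperfilter ℕ).map (orbitMeasure g x)
  have hF : Filter.Tendsto (orbitMeasure g x) (Filter.hyperfilter ℕ) (𝓝 F.lim) := F.le_nhds_lim
  set μ := F.lim
  have hlim : ∀ f : X → ℤ, Continuous f → Filter.Tendsto
      (fun n : ℕ => ((n : ℝ) + 1)⁻¹ * (birkhoffSum g f (n + 1) x : ℤ)) (Filter.hyperfilter ℕ)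
      (𝓝 (∫ y, (f y : ℝ) ∂(μ : Measure X))) := by
    intro f hf
    have h1 := ((ProbabilityMeasure.continuous_integral_continuousMap
      (⟨fun x => (f x : ℝ), continuous_of_discreteTopology.comp hf⟩ : C(X, ℝ))).tendsto μ).comp hF
    refine h1.congr fun n => ?_
    exact integral_orbitMeasure g x n hf
  have hhyper : (Filter.hyperfilter ℕ : Filter ℕ) ≤ Filter.atTop := Nat.hyperfilter_le_atTop
  refine ⟨μ, ?_, fun f hf hnn => ge_of_tendsto' (hlim f hf) fun n => ?_⟩
  · refine ext_of_isClopen fun U hU => ?_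
    rw [Measure.map_apply g.continuous.measurable hU.isOpen.measurableSet]
    have hgU : IsClopen (g ⁻¹' U) := hU.preimage g.continuous
    refine (measureReal_eq_measureReal_iff).1 (sub_eq_zero.1 ?_)
    rw [← integral_surplus hgU hU]
    refine tendsto_nhds_unique (hlim _ (continuous_surplus hgU hU)) ?_
    have hS : ∀ n, birkhoffSum g (surplus (g ⁻¹' U) U) n x =
        U.indicator 1 (g^[n] x) - U.indicator 1 x := by
      intro n
      induction n with
      | zero => simp
      | succ n ih =>
        rw [birkhoffSum_succ, ih]
        simp only [surplus, Pi.sub_apply]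
        rw [Function.iterate_succ_apply']
        have : (g ⁻¹' U).indicator (1 : X → ℤ) (g^[n] x) = U.indicator 1 (g (g^[n] x)) := rfl
        rw [this]; ring
    have hz : Filter.Tendsto (fun n : ℕ => ((n : ℝ) + 1)⁻¹) (Filter.hyperfilter ℕ) (𝓝 0) := by
      simpa [one_div] using tendsto_one_div_add_atTop_nhds_zero_nat (𝕜 := ℝ) |>.mono_left hhyper
    refine squeeze_zero_norm (fun n => ?_) hz
    rw [norm_mul, norm_inv, hS]
    have h1 : ‖(n : ℝ) + 1‖ = (n : ℝ) + 1 := by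
      rw [Real.norm_eq_abs, abs_of_nonneg]; positivity
    rw [h1]
    refine mul_le_of_le_one_right (by positivity) ?_
    generalize g^[n + 1] x = y
    by_cases ha : y ∈ U <;> by_cases hb : x ∈ U <;> simp [ha, hb]
  · have := hnn (n + 1)
    positivity

variable [Nonempty X] [PerfectSpace X] {g : X ≃ₜ X}

lemma isCompact_invariantMeasures (g : X ≃ₜ X) : IsCompact (invariantMeasures g) := by
  have : invariantMeasures g = ⋂ U : {U : Set X // IsClopen U},
      {μ : ProbabilityMeasure X |
        (μ : Measure X).real (g ⁻¹' U) = (μ : Measure X).real (U : Set X)} := by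
    ext μ
    simp only [mem_iInter, Subtype.forall]
    constructor
    · intro h U _
      exact (measureReal_eq_measureReal_iff).2 (measure_preimage_of_mem_invariantMeasures h U)
    · intro h
      refine ext_of_isClopen fun U hU => ?_
      rw [Measure.map_apply g.continuous.measurable hU.isOpen.measurableSet]
      exact (measureReal_eq_measureReal_iff).1 (h U hU)
  rw [this]
  exact (isClosed_iInter fun U => isClosed_eq
    (continuous_measureReal_of_isClopen (U.2.preimage g.continuous))
    (continuous_measureReal_of_isClopen U.2)).isCompact

lemma convex_invariantMeasures (g : X ≃ₜ X) :
    Convex ℝ≥0 (ProbabilityMeasure.toFiniteMeasure '' invariantMeasures g) := by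
  rintro _ ⟨μ, hμ, rfl⟩ _ ⟨ν, hν, rfl⟩ a b _ _ hab
  have hμ' : (μ : Measure X).map g = (μ : Measure X) := hμ
  have hν' : (ν : Measure X).map g = (ν : Measure X) := hν
  have hp : IsProbabilityMeasure (a • (μ : Measure X) + b • (ν : Measure X)) := ⟨by
    have : (a : ENNReal) + b = 1 := by exact_mod_cast hab
    simpa using this⟩
  refine ⟨⟨a • (μ : Measure X) + b • (ν : Measure X), hp⟩, ?_, ?_⟩
  · change (a • (μ : Measure X) + b • (ν : Measure X)).map g =
      a • (μ : Measure X) + b • (ν : Measure X)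
    rw [Measure.map_add _ _ g.continuous.measurable, Measure.map_smul, Measure.map_smul,
      hμ', hν']
  · exact Subtype.ext rfl

lemma IsMinimalHomeo.zpow_apply_ne (hg : IsMinimalHomeo g) (x : X) {n : ℤ} (hn : n ≠ 0) :
    (g ^ n) x ≠ x := by
  intro h
  -- a periodic orbit would be finite and dense
  have hper : ∀ m : ℤ, (g ^ m) x = (g ^ (m % n)) x := by
    intro m
    have hk : ∀ k : ℤ, ((g ^ n) ^ k) x = x := by
      intro k
      let S : Subgroup (X ≃ₜ X) :=
        { carrier := {k | k x = x}
          mul_mem' := fun {a b} ha hb => (congrArg a hb).trans ha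
          one_mem' := rfl
          inv_mem' := fun {a} ha => (a.symm_apply_eq).2 (Eq.symm ha) }
      exact S.zpow_mem (x := g ^ n) h k
    conv_lhs => rw [← Int.emod_add_mul_ediv m n, zpow_add, zpow_mul]
    exact congrArg _ (hk _)
  have hfin : (range fun m : ℤ => (g ^ m) x).Finite := by
    refine ((Set.finite_Ico (0 : ℤ) |n|).image fun m => (g ^ m) x).subset ?_
    rintro _ ⟨m, rfl⟩
    exact ⟨m % n, ⟨Int.emod_nonneg _ hn, Int.emod_lt_abs _ hn⟩, (hper m).symm⟩
  have huniv : (univ : Set X).Finite := by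
    have h2 := (hg x).closure_eq
    rw [hfin.isClosed.closure_eq] at h2
    rwa [h2] at hfin
  exact (infinite_of_mem_nhds x Filter.univ_mem) huniv

/-- The invariant measures of a minimal homeomorphism form a good system. Goodness is parenthesis
matching: a point of `A` without partner would give an invariant measure `μ` with `μ B ≤ μ A`. -/
lemma IsMinimalHomeo.isGoodSystem (hg : IsMinimalHomeo g) :
    IsGoodSystem (invariantMeasures g) where
  nonempty := by
    obtain ⟨x⟩ := ‹Nonempty X›
    obtain ⟨μ, hμ, -⟩ := exists_invariantMeasure g x
    exact ⟨μ, hμ⟩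
  isCompact := isCompact_invariantMeasures g
  atomless := by
    intro μ hμ x
    by_contra h0
    have hinj : ∀ i j : ℤ, (g ^ i) x = (g ^ j) x → i = j := by
      intro i j hij
      by_contra hne
      refine hg.zpow_apply_ne x (sub_ne_zero.2 hne) ((g ^ j).injective ?_)
      rw [← hij]
      change (g ^ j * g ^ (i - j)) x = _
      rw [← zpow_add]; congr 2; ring
    have hconst : ∀ i : ℤ, (μ : Measure X) {(g ^ i) x} = (μ : Measure X) {x} := fun i => by
      rw [← measure_image_of_mem_invariantMeasures (mem_invariantMeasures_zpow hμ i) {x},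
        image_singleton]
    have hfin := Measure.finite_const_le_meas_of_disjoint_iUnion (μ : Measure X)
      (pos_iff_ne_zero.2 h0) (As := fun i : ℤ => {(g ^ i) x}) (fun i => .singleton _)
      (fun i j hij => by
        simpa [Function.onFun] using fun h => hij (hinj i j h)) (measure_ne_top _ _)
    simp only [hconst, le_refl] at hfin
    exact Set.infinite_univ (α := ℤ) (by simpa using hfin)
  fullSupport := by
    refine fun μ hμ => ⟨fun U hU hne h0 => ?_⟩
    have hcov : univ ⊆ ⋃ n : ℤ, (g ^ n) ⁻¹' U := fun x _ => by
      obtain ⟨_, hy, n, rfl⟩ := (hg x).inter_open_nonempty U hU hne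
      exact mem_iUnion.2 ⟨n, hy⟩
    have : (μ : Measure X) univ ≤ 0 := (measure_mono hcov).trans
      ((measure_iUnion_null fun n => by
        rw [measure_preimage_of_mem_invariantMeasures (mem_invariantMeasures_zpow hμ n), h0]).le)
    simp at this
  good := by
    intro A B hA hB hlt
    obtain ⟨e, he, hinj, hmaps⟩ := exists_matching g hA hB fun x _ => by
      by_contra! hpos
      obtain ⟨μ, hμ, h⟩ := exists_invariantMeasure g x
      have h1 := h _ (continuous_surplus hA hB) fun n => by
        cases n with
        | zero => simp
        | succ n => exact (hpos n).le
      rw [integral_surplus hA hB] at h1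
      have h2 : (μ : Measure X).real A < (μ : Measure X).real B := by
        simpa using hlt μ hμ
      linarith
    refine ⟨_, isClopen_image_iterate g hA he, hmaps.image_subset, fun μ hμ => ?_⟩
    simp only [ProbabilityMeasure.coeFn_def, measure_image_iterate hA he hinj hμ]

end Forward

/-! ### Division of clopen sets and separation -/

section Division

variable {X : Type*} [TopologicalSpace X] [CompactSpace X]
  [TopologicalSpace.MetrizableSpace X] [TotallyDisconnectedSpace X]
  [MeasurableSpace X] [BorelSpace X] {K : Set (ProbabilityMeasure X)}

lemma continuous_indicator_of_isClopen {U : Set X} (hU : IsClopen U) {f : X → ℤ}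
    (hf : Continuous f) : Continuous (U.indicator f) :=
  hf.indicator (by simp [hU.frontier_eq])

lemma integral_indicator_intCast {U : Set X} (hU : IsClopen U) (a : ℤ) (μ : Measure X)
    [IsFiniteMeasure μ] :
    ∫ x, ((U.indicator (fun _ => a) x : ℤ) : ℝ) ∂μ = a * μ.real U := by
  have : ∀ x, ((U.indicator (fun _ => a) x : ℤ) : ℝ) = U.indicator (fun _ => (a : ℝ)) x := by
    intro x
    by_cases hx : x ∈ U <;> simp [hx]
  simp only [this]
  rw [integral_indicator_const _ hU.isOpen.measurableSet, smul_eq_mul, mul_comm]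

lemma integral_add_intCast {f h : X → ℤ} (hf : Continuous f) (hh : Continuous h) (μ : Measure X)
    [IsFiniteMeasure μ] :
    ∫ x, ((f x + h x : ℤ) : ℝ) ∂μ = ∫ x, (f x : ℝ) ∂μ + ∫ x, (h x : ℝ) ∂μ := by
  simp only [Int.cast_add]
  exact integral_add (integrable_intCast hf μ) (integrable_intCast hh μ)

lemma integral_sub_intCast {f h : X → ℤ} (hf : Continuous f) (hh : Continuous h) (μ : Measure X)
    [IsFiniteMeasure μ] :
    ∫ x, ((f x - h x : ℤ) : ℝ) ∂μ = ∫ x, (f x : ℝ) ∂μ - ∫ x, (h x : ℝ) ∂μ := by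
  simp only [Int.cast_sub]
  exact integral_sub (integrable_intCast hf μ) (integrable_intCast hh μ)

/-- Division with remainder: the function `f`, cut off to a finite union of small clopen sets, is
up to `K`-equivalence `m` times the indicator of a clopen set `B` plus a remainder `c < m`
supported on `E`. The small sets are absorbed one at a time: each is moved into `E`, where `c`
counts modulo `m`, and the carries are moved back to form `B`. -/
lemma IsGoodSystem.exists_division_finset (hK : IsGoodSystem K) {m : ℤ} (hm : 1 ≤ m) {E : Set X}
    (hE : IsClopen E) {f : X → ℤ} (hf : Continuous f) (h0 : ∀ x, 0 ≤ f x) (hfm : ∀ x, f x ≤ m)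
    (V : X → Set X) (hV : ∀ x, IsClopen (V x))
    (hVE : ∀ x, ∀ μ ∈ K, (μ : Measure X).real (V x) < (μ : Measure X).real E)
    (hVf : ∀ x, ∀ y ∈ V x, f y = f x) (s : Finset X) :
    ∃ B : Set X, IsClopen B ∧ B ⊆ (⋃ x ∈ s, V x) ∩ {x | f x ≠ 0} ∧
      ∃ c : X → ℤ, Continuous c ∧ (∀ x, 0 ≤ c x) ∧ (∀ x, c x < m) ∧ (∀ x ∉ E, c x = 0) ∧
        ∀ ν ∈ respecting K, m * (ν : Measure X).real B + ∫ x, (c x : ℝ) ∂(ν : Measure X) =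
          ∫ x, (((⋃ x ∈ s, V x).indicator f x : ℤ) : ℝ) ∂(ν : Measure X) := by
  classical
  induction s using Finset.induction_on with
  | empty =>
    exact ⟨∅, isClopen_empty, by simp, fun _ => 0, continuous_const, fun _ => le_rfl,
      fun _ => by dsimp only; omega, fun _ _ => rfl, by simp⟩
  | insert x s _ ih =>
    obtain ⟨B, hB, hBs, c, hc, hc0, hcm, hcE, hBc⟩ := ih
    set S := ⋃ x ∈ s, V x with hSdef
    have hS : IsClopen S := s.finite_toSet.isClopen_biUnion fun x _ => hV x
    set D := V x \ S with hDdef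
    have hD : IsClopen D := (hV x).diff hS
    have hSD : ⋃ y ∈ insert x s, V y = S ∪ D := by
      rw [Finset.set_biUnion_insert, hDdef, union_sdiff_self, union_comm]
    have hind : ∀ y, (⋃ y ∈ insert x s, V y).indicator f y =
        S.indicator f y + D.indicator (fun _ => f x) y := by
      intro y
      rw [hSD]
      by_cases h1 : y ∈ S
      · have h2 : y ∉ D := fun h => h.2 h1
        simp [h1, h2]
      · by_cases h2 : y ∈ D
        · simp [h1, h2, hVf x y h2.1]
        · simp [h1, h2]
    simp only [hind]
    have hint : ∀ ν : ProbabilityMeasure X,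
        ∫ y, ((S.indicator f y + D.indicator (fun _ => f x) y : ℤ) : ℝ) ∂(ν : Measure X) =
        ∫ y, ((S.indicator f y : ℤ) : ℝ) ∂(ν : Measure X) +
          f x * (ν : Measure X).real D := fun ν => by
      rw [integral_add_intCast (continuous_indicator_of_isClopen hS hf)
        (continuous_indicator_of_isClopen hD continuous_const), integral_indicator_intCast hD]
    simp only [hint]
    rcases (h0 x).eq_or_lt with ha | ha
    · refine ⟨B, hB, ?_, c, hc, hc0, hcm, hcE, fun ν hν => by rw [hBc ν hν, ← ha]; simp⟩
      exact hBs.trans (inter_subset_inter_left _ (by rw [hSD]; exact subset_union_left))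
    obtain ⟨D', hD', hD'E, hD'D⟩ := hK.good.exists_subset hD hE fun μ hμ =>
      (measureReal_mono sdiff_subset).trans_lt (hVE x μ hμ)
    set P := D' ∩ {y | m ≤ c y + f x} with hPdef
    have hP : IsClopen P := hD'.inter <| by
      convert (isClopen_discrete (Ici (m - f x))).preimage hc using 1
      ext y; simp
    obtain ⟨Q, hQ, hQD, hQP⟩ := hK.exists_transport hD' hD hD'D hP inter_subset_left
    have hBQ : Disjoint B Q := disjoint_left.2 fun y hy hy' => (hQD hy').2 (hBs hy).1
    have hc' : Continuous fun y => c y + D'.indicator (fun _ => f x) y :=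
      hc.add (continuous_indicator_of_isClopen hD' continuous_const)
    have hm' : Continuous (P.indicator fun _ => m) :=
      continuous_indicator_of_isClopen hP continuous_const
    have hcases : ∀ y, c y + D'.indicator (fun _ => f x) y - P.indicator (fun _ => m) y =
        if y ∈ D' then (if m ≤ c y + f x then c y + f x - m else c y + f x) else c y := by
      intro y
      by_cases h1 : y ∈ D' <;> by_cases h2 : m ≤ c y + f x <;> simp [hPdef, h1, h2]
    refine ⟨B ∪ Q, hB.union hQ, ?_,
      fun y => c y + D'.indicator (fun _ => f x) y - P.indicator (fun _ => m) y, hc'.sub hm',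
      fun y => ?_, fun y => ?_, fun y hy => ?_, fun ν hν => ?_⟩
    · rw [hSD]
      refine union_subset (hBs.trans (inter_subset_inter_left _ subset_union_left)) fun y hy => ?_
      exact ⟨.inr (hQD hy), by rw [mem_ofPred_eq, hVf x y (hQD hy).1]; omega⟩
    · beta_reduce; rw [hcases]
      have := hc0 y
      split_ifs <;> omega
    · beta_reduce; rw [hcases]
      have := hcm y
      have := hfm x
      split_ifs <;> omega
    · beta_reduce; rw [hcases, if_neg fun h => hy (hD'E h), hcE y hy]
    · rw [integral_sub_intCast hc' hm', integral_add_intCast hc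
        (continuous_indicator_of_isClopen hD' continuous_const), integral_indicator_intCast hD',
        integral_indicator_intCast hP, measureReal_union hBQ hQ.isOpen.measurableSet,
        ← hBc ν hν, hν _ _ hD' hD hD'D, hν _ _ hQ hP hQP]
      ring

/-- Every integer function `0 ≤ f ≤ m` is uniformly close to `m` times the indicator of a clopen
set, in the sense of integrals. -/
lemma IsGoodSystem.exists_division (hK : IsGoodSystem K) {m : ℤ} (hm : 1 ≤ m) {E : Set X}
    (hE : IsClopen E) (hne : E.Nonempty) {f : X → ℤ} (hf : Continuous f) (h0 : ∀ x, 0 ≤ f x)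
    (hfm : ∀ x, f x ≤ m) :
    ∃ B : Set X, IsClopen B ∧ B ⊆ {x | f x ≠ 0} ∧ ∀ ν ∈ respecting K,
      m * (ν : Measure X).real B ≤ ∫ x, (f x : ℝ) ∂(ν : Measure X) ∧
      ∫ x, (f x : ℝ) ∂(ν : Measure X) ≤
        m * (ν : Measure X).real B + m * (ν : Measure X).real E := by
  have hV : ∀ x, ∃ V : Set X, IsClopen V ∧ x ∈ V ∧ (∀ y ∈ V, f y = f x) ∧
      ∀ μ ∈ K, (μ : Measure X).real V < (μ : Measure X).real E := by
    intro x
    obtain ⟨V, hV, hx, h⟩ := hK.exists_nhd_lt hE hne x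
    exact ⟨V ∩ f ⁻¹' {f x}, hV.inter (isClopen_preimage_discrete hf _), ⟨hx, rfl⟩,
      fun y hy => hy.2, fun μ hμ => (measureReal_mono inter_subset_left).trans_lt (h μ hμ)⟩
  choose V hV hx hVf hVE using hV
  obtain ⟨s, hs⟩ := isCompact_univ.elim_finite_subcover V (fun x => (hV x).isOpen)
    fun x _ => mem_iUnion.2 ⟨x, hx x⟩
  obtain ⟨B, hB, hBs, c, hc, hc0, hcm, hcE, h⟩ :=
    hK.exists_division_finset hm hE hf h0 hfm V hV hVE hVf s
  refine ⟨B, hB, hBs.trans inter_subset_right, fun ν hν => ?_⟩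
  have h1 := h ν hν
  rw [univ_subset_iff.1 hs, indicator_univ] at h1
  have h2 : 0 ≤ ∫ x, (c x : ℝ) ∂(ν : Measure X) :=
    integral_nonneg fun x => by simpa using hc0 x
  have h3 : ∫ x, (c x : ℝ) ∂(ν : Measure X) ≤ m * (ν : Measure X).real E := by
    rw [← integral_indicator_intCast hE]
    refine integral_mono (integrable_intCast hc _)
      (integrable_intCast (continuous_indicator_of_isClopen hE continuous_const) _) fun x => ?_
    have : c x ≤ E.indicator (fun _ => m) x := by
      by_cases hxE : x ∈ E
      · simpa [hxE] using (hcm x).le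
      · simp [hxE, hcE x hxE]
    exact Int.cast_le.2 this
  constructor <;> linarith

/-- Approximate divisibility follows from goodness. -/
lemma IsGoodSystem.isApproximatelyDivisible (hK : IsGoodSystem K) :
    IsApproximatelyDivisible K := by
  intro A hA n hn ε hε
  obtain ⟨μ₀, h₀⟩ := hK.nonempty
  have hn' : (0 : ℝ) < n := by exact_mod_cast hn
  obtain ⟨E, hE, -, hne, hEε⟩ := hK.exists_small_subset (ε := ε / n) (by positivity)
    isClopen_univ (μ₀.nonempty.elim fun x => ⟨x, mem_univ x⟩)
  obtain ⟨B, hB, hBf, h⟩ := hK.exists_division (m := n) (by exact_mod_cast hn) hE hne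
    (f := A.indicator fun _ => 1) (continuous_indicator_of_isClopen hA continuous_const)
    (fun x => indicator_nonneg (fun _ _ => zero_le_one) x) (fun x => by
      have : (1 : ℤ) ≤ n := by exact_mod_cast hn
      by_cases hx : x ∈ A
      · simpa [hx]
      · simp [hx])
  refine ⟨B, hB, fun x hx => by_contra fun hxA => hBf hx (by simp [hxA]), fun μ hμ => ?_⟩
  have h1 := h μ (subset_respecting K hμ)
  rw [integral_indicator_intCast hA] at h1
  have h2 := hEε μ hμ
  rw [lt_div_iff₀ hn'] at h2
  simp only [ProbabilityMeasure.measureReal_eq_coe_coeFn, Int.cast_natCast, Int.cast_one,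
    one_mul] at h1 h2
  constructor <;> linarith

lemma IsGoodSystem.exists_small_respecting (hK : IsGoodSystem K) {ε : ℝ} (hε : 0 < ε) :
    ∃ E : Set X, IsClopen E ∧ E.Nonempty ∧ ∀ ν ∈ respecting K, (ν : Measure X).real E < ε := by
  obtain ⟨μ₀, h₀⟩ := hK.nonempty
  obtain ⟨n, hn⟩ := exists_nat_one_div_lt hε
  have hn' : (0 : ℝ) < n + 1 := by positivity
  obtain ⟨E, hE, -, hne, hEε⟩ := hK.exists_small_subset (ε := 1 / (n + 1)) (by positivity)
    isClopen_univ (μ₀.nonempty.elim fun x => ⟨x, mem_univ x⟩)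
  obtain ⟨B, hB, -, h⟩ := hK.exists_division (m := n + 1) (by omega) hE hne
    (f := fun _ => 1) continuous_const (fun _ => zero_le_one) (fun _ => by omega)
  simp only [Int.cast_one, integral_const, probReal_univ, smul_eq_mul, mul_one, Int.cast_add,
    Int.cast_natCast] at h
  refine ⟨B, hB, ?_, fun ν hν => ?_⟩
  · have h1 := (h μ₀ (subset_respecting K h₀)).2
    have h2 := hEε μ₀ h₀
    rw [lt_div_iff₀ hn'] at h2
    refine nonempty_of_measureReal_ne_zero (μ := (μ₀ : Measure X)) fun h3 => ?_
    rw [h3] at h1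
    linarith
  · refine lt_of_le_of_lt ?_ hn
    rw [le_div_iff₀ hn']
    linarith [(h ν hν).1]

/-- A measure respecting `K`-equivalence cannot be separated from `K` by the integral of a
continuous integer function: dividing the function and the constant by a large number gives clopen
sets to which goodness applies. -/
lemma IsGoodSystem.not_separated (hK : IsGoodSystem K) {ν : ProbabilityMeasure X}
    (hν : ν ∈ respecting K) {f : X → ℤ} (hf : Continuous f) {c : ℤ} {δ : ℝ} (hδ : 0 < δ)
    (h1 : ∫ x, (f x : ℝ) ∂(ν : Measure X) < c) :
    ¬ ∀ μ ∈ K, c + δ < ∫ x, (f x : ℝ) ∂(μ : Measure X) := by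
  intro h2
  obtain ⟨N, hN⟩ : ∃ N : ℤ, ∀ x, |f x| ≤ N := by
    obtain ⟨C, hC⟩ := (isCompact_range (continuous_abs.comp hf)).bddAbove
    exact ⟨C, fun x => hC ⟨x, rfl⟩⟩
  set M := |N| + |c| with hM
  have hfM : ∀ x, 0 ≤ f x + M ∧ f x + M ≤ 2 * M + 1 := fun x => by
    have := abs_le.1 (hN x)
    have := le_abs_self N
    have := abs_nonneg c
    constructor <;> omega
  have hcM : 0 ≤ c + M ∧ c + M ≤ 2 * M + 1 := by
    have := le_abs_self c
    have := neg_abs_le c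
    have := abs_nonneg N
    constructor <;> omega
  set m := 2 * M + 1 with hm
  have hm1 : 1 ≤ m := by omega
  have hmR : (0 : ℝ) < m := by exact_mod_cast hm1
  have hν1 := sub_pos.2 h1
  obtain ⟨E, hE, hne, hEs⟩ := hK.exists_small_respecting
    (ε := min δ (c - ∫ x, (f x : ℝ) ∂(ν : Measure X)) / m)
    (div_pos (lt_min hδ hν1) hmR)
  have hEs' : ∀ μ ∈ respecting K,
      m * (μ : Measure X).real E < min δ (c - ∫ x, (f x : ℝ) ∂(ν : Measure X)) := fun μ hμ => by
    have := hEs μ hμ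
    rw [lt_div_iff₀ hmR] at this
    linarith
  have hcM' : Continuous fun _ : X => M := continuous_const
  obtain ⟨B, hB, -, hBf⟩ := hK.exists_division hm1 hE hne (f := fun x => f x + M)
    (hf.add hcM') (fun x => (hfM x).1) fun x => (hfM x).2
  obtain ⟨C, hC, -, hCc⟩ := hK.exists_division hm1 hE hne (f := fun _ => c + M)
    continuous_const (fun x => hcM.1) fun x => hcM.2
  have hfi : ∀ μ : ProbabilityMeasure X, ∫ x, ((f x + M : ℤ) : ℝ) ∂(μ : Measure X) =
      ∫ x, (f x : ℝ) ∂(μ : Measure X) + M := fun μ => by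
    rw [integral_add_intCast hf hcM']; simp
  simp only [hfi] at hBf
  simp only [integral_const, probReal_univ, smul_eq_mul, one_mul, Int.cast_add] at hCc
  obtain ⟨A, hA, hAB, hAC⟩ := hK.good.exists_subset hC hB fun μ hμ => by
    have hμ' := subset_respecting K hμ
    have e1 := (hBf μ hμ').2
    have e2 := (hCc μ hμ').1
    have e3 := (hEs' μ hμ').trans_le (min_le_left _ _)
    have e4 := h2 μ hμ
    have : m * (μ : Measure X).real C < m * (μ : Measure X).real B := by linarith
    exact lt_of_mul_lt_mul_left this hmR.le
  have e0 : (ν : Measure X).real C ≤ (ν : Measure X).real B := by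
    rw [← hν A C hA hC hAC]; exact measureReal_mono hAB
  have e1 := (hBf ν hν).1
  have e2 := (hCc ν hν).2
  have e3 := (hEs' ν hν).trans_le (min_le_right _ _)
  have e4 := mul_le_mul_of_nonneg_left e0 hmR.le
  linarith

lemma convex_image_measureReal (hconv : Convex ℝ≥0 (ProbabilityMeasure.toFiniteMeasure '' K))
    {ι : Type*} (U : ι → Set X) :
    Convex ℝ ((fun (μ : ProbabilityMeasure X) (i : ι) => (μ : Measure X).real (U i)) '' K) := by
  rintro _ ⟨μ, hμ, rfl⟩ _ ⟨ν, hν, rfl⟩ a b ha hb hab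
  lift a to ℝ≥0 using ha
  lift b to ℝ≥0 using hb
  obtain ⟨ρ, hρ, hρe⟩ := hconv ⟨μ, hμ, rfl⟩ ⟨ν, hν, rfl⟩ (zero_le (a := a)) (zero_le (a := b))
    (by exact_mod_cast hab)
  refine ⟨ρ, hρ, funext fun i => ?_⟩
  have : (ρ : Measure X) = a • (μ : Measure X) + b • (ν : Measure X) :=
    congrArg (fun m : FiniteMeasure X => (m : Measure X)) hρe
  change (ρ : Measure X).real _ = (a : ℝ) * (μ : Measure X).real _ + b * (ν : Measure X).real _
  rw [this, measureReal_add_apply, measureReal_nnreal_smul_apply, measureReal_nnreal_smul_apply]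

/-- A measure that respects `K`-equivalence belongs to `K`, if `K` is convex. By compactness it
suffices to find measures in `K` agreeing with `ν` on finitely many clopen sets; otherwise a
finite-dimensional separation, with rounded coefficients, contradicts `not_separated`. -/
theorem IsGoodSystem.mem_of_mem_respecting (hK : IsGoodSystem K)
    (hconv : Convex ℝ≥0 (ProbabilityMeasure.toFiniteMeasure '' K)) {ν : ProbabilityMeasure X}
    (hν : ν ∈ respecting K) : ν ∈ K := by
  have hfin : ∀ s : Finset {U : Set X // IsClopen U},
      ∃ μ ∈ K, ∀ U ∈ s, (μ : Measure X).real (U : Set X) = (ν : Measure X).real (U : Set X) := by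
    intro s
    by_contra! hcon
    let Φ : ProbabilityMeasure X → (s → ℝ) := fun μ U => (μ : Measure X).real (U.1 : Set X)
    have hΦ : Continuous Φ := continuous_pi fun U => continuous_measureReal_of_isClopen U.1.2
    obtain ⟨φ, u, hνu, hKu⟩ := geometric_hahn_banach_point_closed (x := Φ ν)
      (convex_image_measureReal hconv fun U : s => (U.1 : Set X))
      (hK.isCompact.image hΦ).isClosed (by
        rintro ⟨μ, hμ, he⟩
        obtain ⟨U, hU, hne⟩ := hcon μ hμ
        exact hne (congrFun he ⟨U, hU⟩))
    classical
    obtain ⟨b, hφ⟩ : ∃ b : s → ℝ, ∀ v, φ v = ∑ i, v i * b i :=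
      ⟨_, fun v => LinearMap.pi_apply_eq_sum_univ φ.toLinearMap v⟩
    obtain ⟨M, hM⟩ := exists_nat_gt ((s.card + 2) / (u - φ (Φ ν)))
    rw [div_lt_iff₀ (sub_pos.2 hνu)] at hM
    let a : s → ℤ := fun i => ⌊M * b i⌋
    let f : X → ℤ := fun x => ∑ i : s, (i.1 : Set X).indicator (fun _ => a i) x
    have hf : Continuous f := continuous_finsetSum _ fun i _ =>
      continuous_indicator_of_isClopen i.1.2 continuous_const
    have hfint : ∀ μ : ProbabilityMeasure X,
        ∫ x, (f x : ℝ) ∂(μ : Measure X) = ∑ i : s, a i * Φ μ i := fun μ => by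
      simp only [f, Int.cast_sum]
      rw [integral_finsetSum _ fun i _ =>
        integrable_intCast (continuous_indicator_of_isClopen i.1.2 continuous_const) _]
      simp only [integral_indicator_intCast (Subtype.prop _)]
      rfl
    have hΦ0 : ∀ μ i, 0 ≤ Φ μ i := fun μ i => measureReal_nonneg
    have hΦ1 : ∀ μ i, Φ μ i ≤ 1 := fun μ i => measureReal_le_one
    have hup : ∀ μ, ∑ i : s, a i * Φ μ i ≤ M * φ (Φ μ) := fun μ => by
      rw [hφ, Finset.mul_sum]
      refine Finset.sum_le_sum fun i _ => ?_
      have := mul_le_mul_of_nonneg_right (Int.floor_le (M * b i)) (hΦ0 μ i)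
      simp only [a]; linarith
    have hlow : ∀ μ, M * φ (Φ μ) - s.card ≤ ∑ i : s, a i * Φ μ i := fun μ => by
      have hc : (s.card : ℝ) = ∑ i : s, (1 : ℝ) := by simp
      rw [hφ, Finset.mul_sum, hc, ← Finset.sum_sub_distrib]
      refine Finset.sum_le_sum fun i _ => ?_
      have h1 := mul_le_mul_of_nonneg_right (Int.sub_one_lt_floor (M * b i)).le
        (hΦ0 μ i)
      have h2 := hΦ1 μ i
      simp only [a]; linarith
    refine hK.not_separated hν hf (c := ⌊M * φ (Φ ν)⌋ + 1) zero_lt_one ?_ fun μ hμ => ?_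
    · rw [hfint]; push_cast
      exact (hup ν).trans_lt (Int.lt_floor_add_one _)
    · rw [hfint]; push_cast
      have h1 := hlow μ
      have h2 := Int.floor_le (M * φ (Φ ν))
      have h3 : M * u ≤ M * φ (Φ μ) :=
        mul_le_mul_of_nonneg_left (hKu _ ⟨μ, hμ, rfl⟩).le (Nat.cast_nonneg M)
      linarith
  obtain ⟨μ, hμ, hμν⟩ := hK.isCompact.inter_iInter_nonempty
    (fun U : {U : Set X // IsClopen U} =>
      {μ : ProbabilityMeasure X | (μ : Measure X).real (U : Set X) = (ν : Measure X).real U})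
    (fun U => isClosed_eq (continuous_measureReal_of_isClopen U.2) continuous_const) fun s => by
      obtain ⟨μ, hμ, h⟩ := hfin s
      exact ⟨μ, hμ, mem_iInter₂.2 h⟩
  have : μ = ν := Subtype.ext (ext_of_isClopen (μ := (μ : Measure X)) (ν := (ν : Measure X))
    fun U hU => (measureReal_eq_measureReal_iff).1 (mem_iInter.1 hμν ⟨U, hU⟩))
  exact this ▸ hμ

end Division

/-! ### Homeomorphisms with finite cycles and merging -/

section Stages

variable {X : Type*} [TopologicalSpace X] [CompactSpace X]
  [TopologicalSpace.MetrizableSpace X] [TotallyDisconnectedSpace X]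
  [MeasurableSpace X] [BorelSpace X] {K : Set (ProbabilityMeasure X)}

/-- Up to the coboundary of a function `w` vanishing on `B`, the function `f` is concentrated on
`B`, where it equals `n`. If `B` meets each finite orbit of `g` once, then `n` is the sum of `f`
along the orbit. -/
structure Concentrates (g : X ≃ₜ X) (B : Set X) (f n w : X → ℤ) : Prop where
  continuous_n : Continuous n
  continuous_w : Continuous w
  w_eq_zero : ∀ x ∈ B, w x = 0
  eq_add : ∀ x, f x = w (g x) - w x + B.indicator n x

lemma Concentrates.neg {g : X ≃ₜ X} {B : Set X} {f n w : X → ℤ} (h : Concentrates g B f n w) :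
    Concentrates g B (-f) (-n) (-w) where
  continuous_n := h.continuous_n.neg
  continuous_w := h.continuous_w.neg
  w_eq_zero x hx := by simp [h.w_eq_zero x hx]
  eq_add x := by
    by_cases hx : x ∈ B <;> simp [h.eq_add x, hx] <;> ring

/-- A stage of the construction: a homeomorphism `g` preserving `K`, all of whose orbits are finite
cycles meeting the clopen base `B` once. Of the cycles only two consequences are recorded: there is
a `g`-invariant continuous retraction onto the base, and every function can be concentrated on the
base. -/
structure IsStage (K : Set (ProbabilityMeasure X)) (g : X ≃ₜ X) (B : Set X) : Prop where
  invariant : K ⊆ invariantMeasures g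
  isClopen : IsClopen B
  nonempty : B.Nonempty
  exists_retraction : ∃ π : X → X, Continuous π ∧ (∀ x, π (g x) = π x) ∧ (∀ x, π x ∈ B) ∧
    ∀ x ∈ B, π x = x
  exists_concentrates : ∀ f : X → ℤ, Continuous f → ∃ n w, Concentrates g B f n w

/-- The stage `(g', B')` refines `(g, B)`: the base shrinks, and `g` is only changed at points that
`g` sends to the base. -/
def Refines (g' : X ≃ₜ X) (B' : Set X) (g : X ≃ₜ X) (B : Set X) : Prop :=
  B' ⊆ B ∧ ∀ x, g x ∉ B → g' x = g x

lemma Refines.refl (g : X ≃ₜ X) (B : Set X) : Refines g B g B := ⟨le_rfl, fun _ _ => rfl⟩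

lemma Refines.trans {g₁ g₂ g₃ : X ≃ₜ X} {B₁ B₂ B₃ : Set X} (h : Refines g₁ B₁ g₂ B₂)
    (h' : Refines g₂ B₂ g₃ B₃) : Refines g₁ B₁ g₃ B₃ :=
  ⟨h.1.trans h'.1, fun x hx => by
    rw [← h'.2 x hx]
    exact h.2 x (by rw [h'.2 x hx]; exact fun hx' => hx (h'.1 hx'))⟩

lemma isStage_one (K : Set (ProbabilityMeasure X)) [Nonempty X] : IsStage K 1 univ where
  invariant μ _ := mem_invariantMeasures_one μ
  isClopen := isClopen_univ
  nonempty := univ_nonempty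
  exists_retraction := ⟨id, continuous_id, fun _ => rfl, fun _ => mem_univ _, fun _ _ => rfl⟩
  exists_concentrates f hf := ⟨f, 0, hf, continuous_const, fun _ _ => rfl, by simp⟩

/-- Merging cycles: for disjoint `K`-equivalent clopen subsets `C`, `D` of the base, the cycles
starting in `C` are followed by cycles starting in `D`, and `D` leaves the base. -/
lemma IsGoodSystem.exists_merge (hK : IsGoodSystem K) {g : X ≃ₜ X} {B : Set X}
    (h : IsStage K g B) {C D : Set X} (hC : IsClopen C) (hD : IsClopen D) (hCD : Disjoint C D)
    (hCB : C ⊆ B) (hDB : D ⊆ B) (hequiv : KEquiv K C D) :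
    ∃ τ : X ≃ₜ X, (∀ x ∈ C, τ x ∈ D) ∧ (∀ x ∈ D, τ x ∈ C) ∧
      (∀ x, x ∉ C → x ∉ D → τ x = x) ∧ IsStage K (τ * g) (B \ D) ∧
      Refines (τ * g) (B \ D) g B ∧ ∀ f n w, Concentrates g B f n w →
        ∃ w', Concentrates (τ * g) (B \ D) f (fun x => n x + C.indicator (n ∘ τ) x) w' := by
  classical
  obtain ⟨τ, hτK, hττ, hτC, hτD, hτ⟩ := hK.exists_swap hC hD hCD hequiv
  obtain ⟨π, hπ, hπg, hπB, hπid⟩ := h.exists_retraction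
  have hDC : ∀ x ∈ D, x ∉ C := fun x hx hx' => disjoint_left.1 hCD hx' hx
  have hconc : ∀ f n w, Concentrates g B f n w →
      ∃ w', Concentrates (τ * g) (B \ D) f (fun x => n x + C.indicator (n ∘ τ) x) w' := by
    intro f n w hc
    -- the mass `n (τ c)` sitting at the start of the second cycle is moved to the start `c` of
    -- the first one, back along the first cycle
    have hS : IsClopen (π ⁻¹' C \ C) := (hC.preimage hπ).diff hC
    have hnτ : Continuous (n ∘ τ) := hc.continuous_n.comp τ.continuous
    refine ⟨fun x => w x - (π ⁻¹' C \ C).indicator (n ∘ τ ∘ π) x - D.indicator n x,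
      hc.continuous_n.add (continuous_indicator_of_isClopen hC hnτ),
      (hc.continuous_w.sub (continuous_indicator_of_isClopen hS (hnτ.comp hπ))).sub
        (continuous_indicator_of_isClopen hD hc.continuous_n), fun x hx => ?_, fun x => ?_⟩
    · have h1 : x ∉ π ⁻¹' C \ C := fun h1 => h1.2 (by rw [← hπid x hx.1]; exact h1.1)
      simp [hc.w_eq_zero x hx.1, h1, hx.2]
    · have hg : (τ * g) x = τ (g x) := rfl
      have hpx := hπg x
      rw [hc.eq_add x, hg]
      by_cases hyC : g x ∈ C
      · have e1 := hτC _ hyC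
        have e2 : τ (g x) ∉ C := hDC _ e1
        have e3 := hπid _ (hDB e1)
        have e4 := hπid _ (hCB hyC)
        have e5 := hc.w_eq_zero _ (hDB e1)
        have e6 := hc.w_eq_zero _ (hCB hyC)
        have e7 : π x = g x := hpx.symm.trans e4
        by_cases hxC : x ∈ C
        · have e8 : g x = x := e7.symm.trans (hπid x (hCB hxC))
          have e9 : x ∉ D := fun hx => hDC x hx hxC
          rw [e8] at e1 e2 e3 e5 e6
          simp [e8, e2, e3, e5, e6, e1, hxC, e9, hCB hxC]
        · by_cases hxD : x ∈ D
          · have e8 : g x = x := e7.symm.trans (hπid x (hDB hxD))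
            exact absurd (e8 ▸ hyC) hxC
          · by_cases hxB : x ∈ B
            · have e8 : g x = x := e7.symm.trans (hπid x hxB)
              exact absurd (e8 ▸ hyC) hxC
            · simp [e1, e2, e3, e5, e6, e7, hyC, hxC, hxD, hxB]
              ring
      · by_cases hyD : g x ∈ D
        · have e1 := hτD _ hyD
          have e2 : τ (g x) ∉ D := fun h' => hDC _ h' e1
          have e5 := hc.w_eq_zero _ (hCB e1)
          have e6 := hc.w_eq_zero _ (hDB hyD)
          have e7 : π x = g x := hpx.symm.trans (hπid _ (hDB hyD))
          by_cases hxB : x ∈ B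
          · have e8 : g x = x := e7.symm.trans (hπid x hxB)
            rw [e8] at e1 e2 e5 hyC hyD
            simp [e8, e1, e2, e5, hyC, hyD, hxB, hπid x hxB, hc.w_eq_zero x hxB]
          · have hxD : x ∉ D := fun h' => hxB (hDB h')
            have hxC : x ∉ C := fun h' => hxB (hCB h')
            simp [e1, e2, e5, e6, e7, hyC, hxC, hxD, hxB]
        · rw [hτ _ hyC hyD]
          by_cases hxC : x ∈ C
          · have e9 : x ∉ D := fun hx => hDC x hx hxC
            have e10 := hπid x (hCB hxC)
            simp [hpx, e10, hxC, hyC, hyD, e9, hCB hxC]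
            ring
          · by_cases hxD : x ∈ D
            · have e10 := hπid x (hDB hxD)
              simp [hpx, e10, hxC, hyC, hyD, hxD, hDB hxD]
              ring
            · by_cases hpC : π x ∈ C <;> by_cases hxB : x ∈ B <;>
                simp [hpx, hxC, hyC, hyD, hxD, hpC, hxB]
  refine ⟨τ, hτC, hτD, hτ, ⟨fun μ hμ => mem_invariantMeasures_mul (hτK hμ) (h.invariant hμ),
    h.isClopen.diff hD, ?_, ?_, fun f hf => ?_⟩, ⟨sdiff_subset, fun x hx => ?_⟩, hconc⟩
  · rcases D.eq_empty_or_nonempty with rfl | ⟨x, hx⟩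
    · simpa using h.nonempty
    · exact ⟨τ x, hCB (hτD x hx), fun h' => hDC _ h' (hτD x hx)⟩
  · refine ⟨fun x => if π x ∈ D then τ (π x) else π x, ?_, fun x => ?_, fun x => ?_,
      fun x hx => ?_⟩
    · refine continuous_if (fun x hx => ?_) (τ.continuous.comp hπ).continuousOn hπ.continuousOn
      have : x ∈ frontier (π ⁻¹' D) := hx
      simp [(hD.preimage hπ).frontier_eq] at this
    · change (if π (τ (g x)) ∈ D then τ (π (τ (g x))) else π (τ (g x))) =
        if π x ∈ D then τ (π x) else π x
      rw [← hπg x]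
      by_cases hyC : g x ∈ C
      · have e1 := hτC _ hyC
        have e2 : g x ∉ D := fun h' => hDC _ h' hyC
        simp [hπid _ (hDB e1), e1, hττ, hπid _ (hCB hyC), e2]
      · by_cases hyD : g x ∈ D
        · have e1 := hτD _ hyD
          have e2 : τ (g x) ∉ D := fun h' => hDC _ h' e1
          simp [hπid _ (hCB e1), e2, hπid _ (hDB hyD), hyD]
        · rw [hτ _ hyC hyD]
    · by_cases hx : π x ∈ D
      · simpa [hx] using ⟨hCB (hτD _ hx), fun h' => hDC _ h' (hτD _ hx)⟩
      · simpa [hx] using hπB x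
    · simp [hπid x hx.1, hx.2]
  · obtain ⟨n, w, hc⟩ := h.exists_concentrates f hf
    obtain ⟨w', hw'⟩ := hconc f n w hc
    exact ⟨_, w', hw'⟩
  · exact hτ _ (fun h' => hx (hCB h')) fun h' => hx (hDB h')

end Stages

/-! ### Making differences of equivalent sets coboundaries -/

section Balancing

variable {X : Type*} [TopologicalSpace X] [CompactSpace X]
  [TopologicalSpace.MetrizableSpace X] [TotallyDisconnectedSpace X]
  [MeasurableSpace X] [BorelSpace X] {K : Set (ProbabilityMeasure X)}

lemma integral_indicator_of_concentrates {g : X ≃ₜ X} {B : Set X} (h : IsStage K g B)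
    {f n w : X → ℤ} (hc : Concentrates g B f n w) {μ : ProbabilityMeasure X} (hμ : μ ∈ K) :
    ∫ x, ((B.indicator n x : ℤ) : ℝ) ∂(μ : Measure X) = ∫ x, (f x : ℝ) ∂(μ : Measure X) := by
  have hwg : Continuous fun x => w (g x) := hc.continuous_w.comp g.continuous
  simp only [hc.eq_add]
  rw [integral_add_intCast (f := fun x => w (g x) - w x) (hwg.sub hc.continuous_w)
    (continuous_indicator_of_isClopen h.isClopen hc.continuous_n),
    integral_sub_intCast hwg hc.continuous_w,
    integral_comp_of_mem_invariantMeasures (h.invariant hμ) fun x => (w x : ℝ)]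
  ring

/-- If `f` has integral zero and `-a ≤ n ≤ b` on the base, with `a ≤ b`, then `{n = b}` has at
most the mass of `{n < 0}`, and merging the former with part of the latter removes the value `b`. -/
lemma IsGoodSystem.exists_lower_max (hK : IsGoodSystem K) {g : X ≃ₜ X} {B : Set X}
    (h : IsStage K g B) {f n w : X → ℤ} (hc : Concentrates g B f n w)
    (hf : ∀ μ ∈ K, ∫ x, (f x : ℝ) ∂(μ : Measure X) = 0) {a b : ℤ} (hb : 1 ≤ b) (hab : a ≤ b)
    (hn : ∀ x ∈ B, -a ≤ n x ∧ n x ≤ b) :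
    ∃ g' B' n' w', IsStage K g' B' ∧ Refines g' B' g B ∧ Concentrates g' B' f n' w' ∧
      ∀ x ∈ B', -a ≤ n' x ∧ n' x ≤ b - 1 := by
  set D := B ∩ n ⁻¹' {b} with hDdef
  set W := B ∩ n ⁻¹' Iio 0 with hWdef
  have hD : IsClopen D := h.isClopen.inter (isClopen_preimage_discrete hc.continuous_n _)
  have hW : IsClopen W := h.isClopen.inter (isClopen_preimage_discrete hc.continuous_n _)
  have hWD : Disjoint W D := disjoint_left.2 fun x hx hx' => by
    have h1 : n x < 0 := hx.2
    have h2 : n x = b := hx'.2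
    omega
  let q : X → ℤ := fun x =>
    B.indicator n x + W.indicator (fun _ => b) x - D.indicator (fun _ => b) x
  have hq1 : Continuous (B.indicator n) :=
    continuous_indicator_of_isClopen h.isClopen hc.continuous_n
  have hq2 : Continuous (W.indicator fun _ => b) :=
    continuous_indicator_of_isClopen hW continuous_const
  have hq3 : Continuous (D.indicator fun _ => b) :=
    continuous_indicator_of_isClopen hD continuous_const
  have hq : Continuous q := (hq1.add hq2).sub hq3
  have hqint : ∀ μ ∈ K, ∫ x, (q x : ℝ) ∂(μ : Measure X) =
      b * ((μ : Measure X).real W - (μ : Measure X).real D) := fun μ hμ => by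
    rw [integral_sub_intCast (f := fun x => B.indicator n x + W.indicator (fun _ => b) x)
      (hq1.add hq2) hq3, integral_add_intCast hq1 hq2,
      integral_indicator_of_concentrates h hc hμ, hf μ hμ, integral_indicator_intCast hW,
      integral_indicator_intCast hD]
    ring
  have hq0 : ∀ x, 0 ≤ q x := by
    intro x
    by_cases hxB : x ∈ B
    · have := hn x hxB
      by_cases h1 : n x < 0
      · have h2 : n x ≠ b := by omega
        simp [q, hWdef, hDdef, hxB, h1, h2]; omega
      · by_cases h2 : n x = b
        · have h3 : ¬ b < 0 := by omega
          simp [q, hWdef, hDdef, hxB, h2, h3]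
        · simp [q, hWdef, hDdef, hxB, h1, h2]; omega
    · simp [q, hWdef, hDdef, hxB]
  have hbR : (0 : ℝ) < b := by exact_mod_cast hb
  obtain ⟨C, hC, hCW, hCD⟩ : ∃ C, IsClopen C ∧ C ⊆ W ∧ KEquiv K C D := by
    rcases (q ⁻¹' Ici 1).eq_empty_or_nonempty with he | hne
    · refine ⟨W, hW, le_rfl, fun μ hμ => ?_⟩
      have hz : ∀ x, q x = 0 := fun x => by
        have h1 := hq0 x
        have h2 : x ∉ q ⁻¹' Ici 1 := by rw [he]; exact notMem_empty x
        have h3 : ¬ 1 ≤ q x := h2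
        omega
      have := hqint μ hμ
      simp only [hz, Int.cast_zero, integral_zero] at this
      have := (mul_eq_zero.1 this.symm).resolve_left hbR.ne'
      linarith
    · refine hK.good.exists_subset hD hW fun μ hμ => ?_
      have hQ : IsClopen (q ⁻¹' Ici 1) := isClopen_preimage_discrete hq _
      have h1 := measureReal_pos_of_isClopen (hK.fullSupport μ hμ) hQ hne
      have h2 : (1 : ℤ) * (μ : Measure X).real (q ⁻¹' Ici 1) ≤ ∫ x, (q x : ℝ) ∂(μ : Measure X) := by
        rw [← integral_indicator_intCast hQ]
        refine integral_mono (integrable_intCast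
          (continuous_indicator_of_isClopen hQ continuous_const) _) (integrable_intCast hq _)
          fun x => Int.cast_le.2 ?_
        by_cases hx : x ∈ q ⁻¹' Ici 1
        · rw [indicator_of_mem hx]; exact hx
        · simpa [hx] using hq0 x
      rw [hqint μ hμ, Int.cast_one, one_mul] at h2
      have := pos_of_mul_pos_right (h1.trans_le h2) hbR.le
      linarith
  obtain ⟨τ, hτC, -, -, hst, href, hconc⟩ := hK.exists_merge h hC hD (hWD.mono_left hCW)
    (hCW.trans inter_subset_left) inter_subset_left hCD
  obtain ⟨w', hw'⟩ := hconc f n w hc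
  refine ⟨_, _, _, w', hst, href, hw', fun x hx => ?_⟩
  have h1 := hn x hx.1
  by_cases hxC : x ∈ C
  · have h2 : n (τ x) = b := (hτC x hxC).2
    have h3 : n x < 0 := (hCW hxC).2
    simp only [indicator_of_mem hxC, Function.comp_apply, h2]
    omega
  · have h2 : n x ≠ b := fun h2 => hx.2 ⟨hx.1, h2⟩
    simp only [indicator_of_notMem hxC]
    omega

/-- Some refinement makes a given function of integral zero a coboundary, by means of a function
vanishing on the base. -/
lemma IsGoodSystem.exists_balance (hK : IsGoodSystem K) {g : X ≃ₜ X} {B : Set X}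
    (h : IsStage K g B) {f : X → ℤ} (hfc : Continuous f)
    (hf : ∀ μ ∈ K, ∫ x, (f x : ℝ) ∂(μ : Measure X) = 0) :
    ∃ g' B', IsStage K g' B' ∧ Refines g' B' g B ∧ ∃ w : X → ℤ, Continuous w ∧
      (∀ x ∈ B', w x = 0) ∧ ∀ x, f x = w (g' x) - w x := by
  have hf' : ∀ μ ∈ K, ∫ x, (((-f) x : ℤ) : ℝ) ∂(μ : Measure X) = 0 := fun μ hμ => by
    simp [integral_neg, hf μ hμ]
  have main : ∀ m : ℕ, ∀ g B n w, IsStage K g B → Concentrates g B f n w →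
      (∀ x ∈ B, -(m : ℤ) ≤ n x ∧ n x ≤ m) → ∃ g' B', IsStage K g' B' ∧ Refines g' B' g B ∧
      ∃ w : X → ℤ, Continuous w ∧ (∀ x ∈ B', w x = 0) ∧ ∀ x, f x = w (g' x) - w x := by
    intro m
    induction m with
    | zero =>
      intro g B n w h hc hn
      refine ⟨g, B, h, .refl g B, w, hc.continuous_w, hc.w_eq_zero, fun x => ?_⟩
      rw [hc.eq_add x]
      by_cases hx : x ∈ B
      · have := hn x hx
        have : n x = 0 := by simp at this; omega
        simp [hx, this]
      · simp [hx]
    | succ m ih =>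
      intro g B n w h hc hn
      obtain ⟨g₁, B₁, n₁, w₁, h₁, hr₁, hc₁, hn₁⟩ := hK.exists_lower_max h hc hf
        (a := m + 1) (b := m + 1) (by omega) le_rfl (by exact_mod_cast hn)
      obtain ⟨g₂, B₂, n₂, w₂, h₂, hr₂, hc₂, hn₂⟩ := hK.exists_lower_max h₁ hc₁.neg hf'
        (a := m) (b := m + 1) (by omega) (by omega) fun x hx => by
          have := hn₁ x hx
          simp only [Pi.neg_apply]
          omega
      have hc₂' := hc₂.neg
      rw [neg_neg] at hc₂'
      obtain ⟨g₃, B₃, h₃, hr₃, hw₃⟩ := ih g₂ B₂ _ _ h₂ hc₂' fun x hx => by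
        have := hn₂ x hx
        simp only [Pi.neg_apply]
        omega
      exact ⟨g₃, B₃, h₃, hr₃.trans (hr₂.trans hr₁), hw₃⟩
  obtain ⟨n, w, hc⟩ := h.exists_concentrates f hfc
  obtain ⟨C, hC⟩ := (isCompact_range (continuous_abs.comp hc.continuous_n)).bddAbove
  refine main C.toNat g B n w h hc fun x _ => abs_le.1 ?_
  exact (hC ⟨x, rfl⟩).trans (Int.self_le_toNat C)

end Balancing

/-! ### Shrinking the base -/

section Shrinking

variable {X : Type*} [TopologicalSpace X] [CompactSpace X]
  [TopologicalSpace.MetrizableSpace X] [TotallyDisconnectedSpace X]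
  [MeasurableSpace X] [BorelSpace X] {K : Set (ProbabilityMeasure X)}

/-- Small pieces of the part `D` of the base are merged with the part `R`. The cycles starting in
`R` are lengthened at their start, hence keep their last points. -/
lemma IsGoodSystem.exists_absorb (hK : IsGoodSystem K) {g : X ≃ₜ X} {A R D : Set X}
    (h : IsStage K g (A ∪ R ∪ D)) (hR : IsClopen R) (hD : IsClopen D)
    (hAR : Disjoint A R) (hAD : Disjoint A D) (hRD : Disjoint R D)
    (V : X → Set X) (hV : ∀ x, IsClopen (V x))
    (hVR : ∀ x, ∀ μ ∈ K, (μ : Measure X).real (V x) < (μ : Measure X).real R) (s : Finset X) :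
    ∃ g' R', IsStage K g' (A ∪ R' ∪ (D \ ⋃ x ∈ s, V x)) ∧
      Refines g' (A ∪ R' ∪ (D \ ⋃ x ∈ s, V x)) g (A ∪ R ∪ D) ∧ IsClopen R' ∧ Disjoint A R' ∧
      Disjoint R' (D \ ⋃ x ∈ s, V x) ∧ KEquiv K R' R ∧ ∀ x, g' x ∈ R' ↔ g x ∈ R := by
  classical
  induction s using Finset.induction_on with
  | empty => exact ⟨g, R, by simpa using h, by simpa using Refines.refl g _, hR, hAR,
      by simpa using hRD, .refl R, fun _ => Iff.rfl⟩
  | insert x s _ ih =>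
    obtain ⟨g', R', h', href, hR', hAR', hRD', hRR', hiff⟩ := ih
    set E := D \ ⋃ x ∈ s, V x with hEdef
    have hE : IsClopen E := hD.diff (s.finite_toSet.isClopen_biUnion fun x _ => hV x)
    have hAE : Disjoint A E := hAD.mono_right sdiff_subset
    set C := E ∩ V x with hCdef
    have hC : IsClopen C := hE.inter (hV x)
    obtain ⟨F, hF, hFR, hFC⟩ := hK.good.exists_subset hC hR' fun μ hμ => by
      rw [hRR' μ hμ]
      exact (measureReal_mono inter_subset_right).trans_lt (hVR x μ hμ)
    have hCF : Disjoint C F := (hRD'.mono hFR inter_subset_left).symm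
    obtain ⟨τ, hτC, hτF, hτ, hst, hr, -⟩ := hK.exists_merge h' hC hF hCF
      (inter_subset_left.trans subset_union_right)
      (hFR.trans (subset_union_right.trans subset_union_left)) hFC.symm
    have hEx : D \ ⋃ y ∈ insert x s, V y = E \ C := by
      rw [Finset.set_biUnion_insert, hCdef, sdiff_self_inter, hEdef, sdiff_sdiff, union_comm]
    have hCR : ∀ y ∈ C, y ∉ R' := fun y hy hy' => disjoint_left.1 hRD' hy' hy.1
    have hbase : (A ∪ R' ∪ E) \ F = A ∪ (R' \ F ∪ C) ∪ (E \ C) := by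
      ext y
      have h1 : y ∈ F → y ∈ R' := fun h => hFR h
      have h2 : y ∈ A → y ∉ R' := fun h h2 => disjoint_left.1 hAR' h h2
      have h3 : y ∈ R' → y ∉ E := fun h h2 => disjoint_left.1 hRD' h h2
      have h4 : y ∈ C → y ∈ E := fun h => h.1
      simp only [mem_sdiff, mem_union]
      tauto
    rw [hbase] at hst hr
    rw [hEx]
    refine ⟨τ * g', R' \ F ∪ C, hst, hr.trans href, (hR'.diff hF).union hC, ?_, ?_, ?_,
      fun y => ?_⟩
    · exact disjoint_union_right.2 ⟨hAR'.mono_right sdiff_subset,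
        hAE.mono_right inter_subset_left⟩
    · exact disjoint_union_left.2 ⟨hRD'.mono sdiff_subset sdiff_subset, disjoint_sdiff_right⟩
    · refine KEquiv.trans (fun μ hμ => ?_) hRR'
      rw [measureReal_union ((hRD'.mono sdiff_subset inter_subset_left)) hC.isOpen.measurableSet,
        measureReal_sdiff hFR hF.isOpen.measurableSet, hFC μ hμ]
      ring
    · rw [← hiff]
      change τ (g' y) ∈ _ ↔ _
      generalize g' y = z
      by_cases hzF : z ∈ F
      · exact iff_of_true (.inr (hτF z hzF)) (hFR hzF)
      · by_cases hzC : z ∈ C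
        · refine iff_of_false ?_ (hCR z hzC)
          rintro (h1 | h1)
          · exact h1.2 (hτC z hzC)
          · exact disjoint_left.1 hCF h1 (hτC z hzC)
        · rw [hτ z hzC hzF]
          simp [hzF, hzC]

lemma exists_subset_decided {B W : Set X} (hB : IsClopen B) (hne : B.Nonempty)
    (hW : IsClopen W) : ∃ P, IsClopen P ∧ P.Nonempty ∧ P ⊆ B ∧ (P ⊆ W ∨ P ⊆ Wᶜ) := by
  rcases (B ∩ W).eq_empty_or_nonempty with he | hne'
  · exact ⟨B, hB, hne, le_rfl, .inr (disjoint_iff_inter_eq_empty.2 he).subset_compl_right⟩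
  · exact ⟨B ∩ W, hB.inter hW, hne', inter_subset_left, .inl inter_subset_right⟩

/-- Some refinement has base, and preimage of the base, on one side of a given clopen set `W`.
To this end small disjoint `K`-equivalent subsets `A` and `R` of the base are chosen such that `A`
lies on one side of `W` and so does the preimage of `R`. The rest of the base is absorbed into the
cycles starting in `R`, which keep their last points, and the resulting cycles are appended to those
starting in `A`. -/
lemma IsGoodSystem.exists_shrink (hK : IsGoodSystem K) [PerfectSpace X] {g : X ≃ₜ X} {B : Set X}
    (h : IsStage K g B) {W : Set X} (hW : IsClopen W) :
    ∃ g' B', IsStage K g' B' ∧ Refines g' B' g B ∧ (B' ⊆ W ∨ B' ⊆ Wᶜ) ∧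
      (g' ⁻¹' B' ⊆ W ∨ g' ⁻¹' B' ⊆ Wᶜ) := by
  obtain ⟨P, hP, ⟨p, hp⟩, hPB, hPW⟩ := exists_subset_decided h.isClopen h.nonempty hW
  obtain ⟨Q, hQ, ⟨q₀, hq₀⟩, hQB, hQW⟩ := exists_subset_decided h.isClopen h.nonempty
    (hW.preimage g.symm.continuous)
  obtain ⟨q, hq, hqp⟩ : ∃ q ∈ Q, q ≠ p := by
    have : Q.Infinite := infinite_of_mem_nhds q₀ (hQ.isOpen.mem_nhds hq₀)
    obtain ⟨q, hq, hqp⟩ := this.exists_notMem_finset {p}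
    exact ⟨q, hq, by simpa using hqp⟩
  obtain ⟨N, hN, hpN, hNq⟩ := exists_isClopen_mem_subset (isOpen_compl_singleton (x := q))
    (show p ∈ ({q} : Set X)ᶜ from fun h => hqp h.symm)
  have hqN : q ∉ N := fun h => hNq h rfl
  obtain ⟨V, hV, hqV, hVP⟩ := hK.exists_nhd_lt (hP.inter hN) ⟨p, hp, hpN⟩ q
  set R := (V ∩ Q) \ N with hRdef
  have hR : IsClopen R := (hV.inter hQ).diff hN
  have hRne : R.Nonempty := ⟨q, ⟨hqV, hq⟩, hqN⟩
  have hRQ : R ⊆ Q := fun x hx => hx.1.2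
  obtain ⟨A, hA, hAPN, hAR⟩ := hK.good.exists_subset hR (hP.inter hN) fun μ hμ =>
    (measureReal_mono fun x hx => hx.1.1).trans_lt (hVP μ hμ)
  have hdAR : Disjoint A R := disjoint_left.2 fun x hx hx' => hx'.2 (hAPN hx).2
  have hAP : A ⊆ P := hAPN.trans inter_subset_left
  set D := B \ (A ∪ R) with hDdef
  have hD : IsClopen D := h.isClopen.diff (hA.union hR)
  have hBeq : B = A ∪ R ∪ D := (union_sdiff_cancel
    (union_subset (hAP.trans hPB) (hRQ.trans hQB))).symm
  choose V' hV' hxV' hV'R using hK.exists_nhd_lt hR hRne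
  obtain ⟨s, hs⟩ := isCompact_univ.elim_finite_subcover V' (fun x => (hV' x).isOpen)
    fun x _ => mem_iUnion.2 ⟨x, hxV' x⟩
  have h' := h
  rw [hBeq] at h'
  obtain ⟨g₁, R₁, h₁, hr₁, hR₁, hAR₁, -, hRR₁, hiff⟩ := hK.exists_absorb h' hR hD hdAR
    (disjoint_left.2 fun x hx hx' => hx'.2 (.inl hx))
    (disjoint_left.2 fun x hx hx' => hx'.2 (.inr hx)) V' hV' hV'R s
  rw [univ_subset_iff.1 hs, sdiff_univ, union_empty] at h₁ hr₁
  obtain ⟨τ, hτA, hτR, hτ, h₂, hr₂, -⟩ := hK.exists_merge h₁ hA hR₁ hAR₁ subset_union_left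
    subset_union_right (hAR.trans hRR₁.symm)
  rw [union_sdiff_cancel_right (disjoint_iff_inter_eq_empty.1 hAR₁).subset] at h₂ hr₂
  have hpre : (τ * g₁) ⁻¹' A = g ⁻¹' R := by
    ext x
    change τ (g₁ x) ∈ A ↔ g x ∈ R
    rw [← hiff]
    generalize g₁ x = z
    by_cases hz : z ∈ R₁
    · exact iff_of_true (hτR z hz) hz
    · refine iff_of_false (fun hzA => ?_) hz
      by_cases hz' : z ∈ A
      · exact disjoint_left.1 hAR₁ hzA (hτA z hz')
      · rw [hτ z hz' hz] at hzA
        exact hz' hzA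
  refine ⟨τ * g₁, A, h₂, by rw [hBeq]; exact hr₂.trans hr₁,
    hPW.imp hAP.trans hAP.trans, ?_⟩
  rw [hpre]
  refine hQW.imp (fun hQW x hx => ?_) fun hQW x hx => ?_
  · simpa using hQW (hRQ hx)
  · simpa using hQW (hRQ hx)

end Shrinking

/-! ### The limit homeomorphism -/

section Limit

variable {X : Type*} [TopologicalSpace X]

lemma Refines.mem_of_mem {g g' : X ≃ₜ X} {B B' : Set X} (h : Refines g' B' g B) {x : X}
    (hx : g x ∈ B) : g' x ∈ B := by
  by_contra hy
  have h1 : g (g.symm (g' x)) = g' x := g.apply_symm_apply _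
  have h2 := h.2 (g.symm (g' x)) (by rwa [h1])
  rw [h1] at h2
  have h3 := g'.injective h2
  rw [h3] at h1
  exact hy (h1 ▸ hx)

lemma Refines.preimage_subset {g g' : X ≃ₜ X} {B B' : Set X} (h : Refines g' B' g B) :
    g' ⁻¹' B' ⊆ g ⁻¹' B := by
  intro x hx
  by_contra hx'
  have h1 : g' x ∈ B' := hx
  rw [h.2 x hx'] at h1
  exact hx' (h.1 h1)

/-- A homeomorphism `g'` extends the partial homeomorphism `g` from the complement of `g ⁻¹' B` to
the complement of `B`. -/
def ExtendsStage (g' g : X ≃ₜ X) (B : Set X) : Prop :=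
  (∀ x, g x ∉ B → g' x = g x) ∧ ∀ x, g x ∈ B → g' x ∈ B

variable [CompactSpace X] [TopologicalSpace.MetrizableSpace X] [TotallyDisconnectedSpace X]
  [MeasurableSpace X] [BorelSpace X] {K : Set (ProbabilityMeasure X)}

/-- A sequence of refining stages whose bases and preimages of bases shrink to points has a limit
homeomorphism. -/
lemma exists_limit {g : ℕ → X ≃ₜ X} {B : ℕ → Set X} (hst : ∀ n, IsStage K (g n) (B n))
    (href : ∀ n, Refines (g (n + 1)) (B (n + 1)) (g n) (B n))
    (hdec : ∀ U : Set X, IsClopen U → ∃ n, (B n ⊆ U ∨ B n ⊆ Uᶜ) ∧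
      (g n ⁻¹' B n ⊆ U ∨ g n ⁻¹' B n ⊆ Uᶜ)) :
    ∃ G : X ≃ₜ X, K ⊆ invariantMeasures G ∧ ∀ n, ExtendsStage G (g n) (B n) := by
  classical
  have hmono : ∀ {m n}, m ≤ n → Refines (g n) (B n) (g m) (B m) := by
    intro m n hmn
    induction n, hmn using Nat.le_induction with
    | base => exact .refl _ _
    | succ n _ ih => exact (href n).trans ih
  have hsep : ∀ x y : X, x ≠ y → ∃ U, IsClopen U ∧ x ∈ U ∧ y ∉ U := by
    intro x y hxy
    obtain ⟨U, hU, hx, hy⟩ := exists_isClopen_mem_subset (isOpen_compl_singleton (x := y)) hxy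
    exact ⟨U, hU, hx, fun h => hy h rfl⟩
  obtain ⟨x₀, hx₀⟩ : (⋂ n, B n).Nonempty :=
    IsCompact.nonempty_iInter_of_sequence_nonempty_isCompact_isClosed _ (fun n => (href n).1)
      (fun n => (hst n).nonempty) (hst 0).isClopen.isClosed.isCompact
      fun n => (hst n).isClopen.isClosed
  obtain ⟨x₁, hx₁⟩ : (⋂ n, g n ⁻¹' B n).Nonempty :=
    IsCompact.nonempty_iInter_of_sequence_nonempty_isCompact_isClosed _
      (fun n => (href n).preimage_subset) (fun n => (hst n).nonempty.preimage (g n).surjective)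
      ((hst 0).isClopen.preimage (g 0).continuous).isClosed.isCompact
      fun n => ((hst n).isClopen.preimage (g n).continuous).isClosed
  rw [mem_iInter] at hx₀ hx₁
  let f : X → X := fun x => if h : ∃ n, g n x ∉ B n then g (Nat.find h) x else x₀
  have hf : ∀ n x, g n x ∉ B n → f x = g n x := by
    intro n x hx
    have h : ∃ n, g n x ∉ B n := ⟨n, hx⟩
    simp only [f, dif_pos h]
    exact ((hmono (Nat.find_min' h hx)).2 x (Nat.find_spec h)).symm
  have hf' : ∀ n x, g n x ∈ B n → f x ∈ B n := by
    intro n x hx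
    by_cases h : ∃ m, g m x ∉ B m
    · obtain ⟨m, hm⟩ := h
      rw [hf m x hm]
      rcases le_total m n with hmn | hmn
      · exact absurd ((hmono hmn).preimage_subset hx) hm
      · exact (hmono hmn).mem_of_mem hx
    · simpa only [f, dif_neg h] using hx₀ n
  have hpre : ∀ U, IsClopen U → ∃ n, f ⁻¹' U = g n ⁻¹' U := by
    intro U hU
    obtain ⟨n, hn, -⟩ := hdec U hU
    refine ⟨n, ?_⟩
    ext x
    simp only [mem_preimage]
    by_cases hx : g n x ∈ B n
    · have hx' := hf' n x hx
      rcases hn with hn | hn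
      · exact iff_of_true (hn hx') (hn hx)
      · exact iff_of_false (hn hx') (hn hx)
    · rw [hf n x hx]
  have hcont : Continuous f := by
    refine loc_compact_Haus_tot_disc_of_zero_dim.continuous_iff.2 fun U hU => ?_
    obtain ⟨n, hn⟩ := hpre U hU
    rw [hn]
    exact hU.isOpen.preimage (g n).continuous
  have hinj : Function.Injective f := by
    intro x y hxy
    by_contra hne
    obtain ⟨U, hU, hxU, hyU⟩ := hsep x y hne
    obtain ⟨n, -, hn⟩ := hdec U hU
    by_cases hx : g n x ∈ B n
    · have hy : g n y ∈ B n := by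
        by_contra hy
        have h1 := hf' n x hx
        rw [hxy, hf n y hy] at h1
        exact hy h1
      rcases hn with hn | hn
      · exact hyU (hn hy)
      · exact hn hx hxU
    · have hy : g n y ∉ B n := by
        intro hy
        have h1 := hf' n y hy
        rw [← hxy, hf n x hx] at h1
        exact hx h1
      rw [hf n x hx, hf n y hy] at hxy
      exact hne ((g n).injective hxy)
  have hsurj : Function.Surjective f := by
    intro y
    by_cases h : ∃ n, y ∉ B n
    · obtain ⟨n, hn⟩ := h
      have h1 : g n ((g n).symm y) = y := (g n).apply_symm_apply y
      exact ⟨(g n).symm y, by rw [hf n _ (by rwa [h1]), h1]⟩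
    · push Not at h
      refine ⟨x₁, ?_⟩
      by_contra hne
      obtain ⟨U, hU, hxU, hyU⟩ := hsep _ _ hne
      obtain ⟨n, hn, -⟩ := hdec U hU
      rcases hn with hn | hn
      · exact hyU (hn (h n))
      · exact hn (hf' n x₁ (hx₁ n)) hxU
  let e : X ≃ X := Equiv.ofBijective f ⟨hinj, hsurj⟩
  refine ⟨(show Continuous e from hcont).homeoOfEquivCompactToT2, fun μ hμ => ?_,
    fun n => ⟨hf n, hf' n⟩⟩
  refine ext_of_isClopen fun U hU => ?_
  refine (Measure.map_apply hcont.measurable hU.isOpen.measurableSet).trans ?_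
  obtain ⟨n, hn⟩ := hpre U hU
  rw [hn]
  exact measure_preimage_of_mem_invariantMeasures ((hst n).invariant hμ) U

/-- There is a homeomorphism preserving `K` for which all differences of indicators of
`K`-equivalent clopen sets are coboundaries. -/
lemma IsGoodSystem.exists_homeo_coboundary (hK : IsGoodSystem K) [Nonempty X] [PerfectSpace X] :
    ∃ G : X ≃ₜ X, K ⊆ invariantMeasures G ∧ ∀ U V, IsClopen U → IsClopen V → KEquiv K U V →
      ∃ w : X → ℤ, Continuous w ∧ ∀ x, surplus U V x = w (G x) - w x := by
  obtain ⟨W, hW, hWs⟩ := exists_enumeration_isClopen X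
  have step : ∀ (p : {p : (X ≃ₜ X) × Set X // IsStage K p.1 p.2}) (n : ℕ),
      ∃ q : {p : (X ≃ₜ X) × Set X // IsStage K p.1 p.2},
        Refines q.1.1 q.1.2 p.1.1 p.1.2 ∧
        ((q.1.2 ⊆ W n ∨ q.1.2 ⊆ (W n)ᶜ) ∧
          (q.1.1 ⁻¹' q.1.2 ⊆ W n ∨ q.1.1 ⁻¹' q.1.2 ⊆ (W n)ᶜ)) ∧
        (KEquiv K (W n.unpair.1) (W n.unpair.2) → ∃ w : X → ℤ, Continuous w ∧
          (∀ x ∈ q.1.2, w x = 0) ∧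
          ∀ x, surplus (W n.unpair.1) (W n.unpair.2) x = w (q.1.1 x) - w x) := by
    rintro ⟨⟨g, B⟩, hst⟩ n
    obtain ⟨g₁, B₁, h₁, hr₁, hd₁, hd₁'⟩ := hK.exists_shrink hst (hW n)
    by_cases he : KEquiv K (W n.unpair.1) (W n.unpair.2)
    · obtain ⟨g₂, B₂, h₂, hr₂, hw⟩ := hK.exists_balance h₁
        (continuous_surplus (hW n.unpair.1) (hW n.unpair.2)) fun μ hμ => by
          rw [integral_surplus (hW _) (hW _), he μ hμ, sub_self]
      exact ⟨⟨(g₂, B₂), h₂⟩, hr₂.trans hr₁, ⟨hd₁.imp hr₂.1.trans hr₂.1.trans,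
        hd₁'.imp hr₂.preimage_subset.trans hr₂.preimage_subset.trans⟩, fun _ => hw⟩
    · exact ⟨⟨(g₁, B₁), h₁⟩, hr₁, ⟨hd₁, hd₁'⟩, fun h => absurd h he⟩
  choose S hSr hSd hSw using step
  let s : ℕ → {p : (X ≃ₜ X) × Set X // IsStage K p.1 p.2} := fun n =>
    Nat.rec ⟨(1, univ), isStage_one K⟩ (fun n p => S p n) n
  obtain ⟨G, hGK, hG⟩ := exists_limit (g := fun n => (s n).1.1) (B := fun n => (s n).1.2)
    (fun n => (s n).2) (fun n => hSr (s n) n) fun U hU => by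
      obtain ⟨n, rfl⟩ := hWs U hU
      exact ⟨n + 1, hSd (s n) n⟩
  refine ⟨G, hGK, fun U V hU hV hUV => ?_⟩
  obtain ⟨i, rfl⟩ := hWs U hU
  obtain ⟨j, rfl⟩ := hWs V hV
  have hn := hSw (s (Nat.pair i j)) (Nat.pair i j)
  rw [Nat.unpair_pair] at hn
  obtain ⟨w, hw, hw0, hwe⟩ := hn hUV
  refine ⟨w, hw, fun x => ?_⟩
  rw [hwe]
  -- `w` vanishes on the base, so it does not matter where in the base the point is sent
  by_cases hx : (s (Nat.pair i j + 1)).1.1 x ∈ (s (Nat.pair i j + 1)).1.2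
  · rw [hw0 _ ((hG (Nat.pair i j + 1)).2 x hx)]
    exact congrArg (· - w x) (hw0 _ hx)
  · rw [(hG (Nat.pair i j + 1)).1 x hx]

end Limit

/-! ### Minimality, saturation and the invariant measures -/

section Conclusion

variable {X : Type*} [TopologicalSpace X] [CompactSpace X]
  [TopologicalSpace.MetrizableSpace X] [TotallyDisconnectedSpace X]
  [MeasurableSpace X] [BorelSpace X] {K : Set (ProbabilityMeasure X)} {g : X ≃ₜ X}

lemma birkhoffSum_coboundary {f w : X → ℤ} (h : ∀ x, f x = w (g x) - w x) (n : ℕ) (x : X) :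
    birkhoffSum g f n x = w (g^[n] x) - w x := by
  induction n with
  | zero => simp
  | succ n ih => rw [birkhoffSum_succ, ih, h, Function.iterate_succ_apply']; ring

/-- Forward orbits are dense: if an orbit avoided the clopen set `U`, then the number of its visits
to any clopen set equivalent to a subset of `U` would be bounded, while finitely many such sets
cover `X`. -/
lemma IsGoodSystem.exists_iterate_mem (hK : IsGoodSystem K)
    (hg : ∀ U V, IsClopen U → IsClopen V → KEquiv K U V →
      ∃ w : X → ℤ, Continuous w ∧ ∀ x, surplus U V x = w (g x) - w x)
    {O : Set X} (hO : IsOpen O) (hne : O.Nonempty) (x : X) : ∃ n, g^[n] x ∈ O := by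
  obtain ⟨y, hy⟩ := hne
  obtain ⟨U, hU, hyU, hUO⟩ := exists_isClopen_mem_subset hO hy
  by_contra! hx
  have hxU : ∀ n, g^[n] x ∉ U := fun n h => hx n (hUO h)
  choose V hV hzV hVU using hK.exists_nhd_lt hU ⟨y, hyU⟩
  choose V' hV' hV'U hVV' using fun z => hK.good.exists_subset (hV z) hU (hVU z)
  choose w hw hwe using fun z => hg _ _ (hV z) (hV' z) (hVV' z).symm
  obtain ⟨s, hs⟩ := isCompact_univ.elim_finite_subcover V (fun z => (hV z).isOpen)
    fun z _ => mem_iUnion.2 ⟨z, hzV z⟩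
  choose C hC using fun z => (isCompact_range (hw z)).bddAbove
  have hnn : ∀ z n, 0 ≤ surplus (V z) (V' z) (g^[n] x) := fun z n =>
    surplus_nonneg (.inr fun h => hxU n (hV'U z h))
  have h1 : ∀ n, 1 ≤ ∑ z ∈ s, surplus (V z) (V' z) (g^[n] x) := fun n => by
    obtain ⟨z, hz, hzn⟩ := mem_iUnion₂.1 (hs (mem_univ (g^[n] x)))
    refine le_trans ?_ (Finset.single_le_sum (fun z _ => hnn z n) hz)
    have : g^[n] x ∉ V' z := fun h => hxU n (hV'U z h)
    simp [surplus, hzn, this]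
  have h2 : ∀ n : ℕ, (n : ℤ) ≤ ∑ z ∈ s, birkhoffSum g (surplus (V z) (V' z)) n x := fun n => by
    simp only [birkhoffSum]
    rw [Finset.sum_comm]
    refine le_trans ?_ (Finset.sum_le_sum fun i _ => h1 i)
    simp
  have h3 : ∀ n : ℕ, (n : ℤ) ≤ ∑ z ∈ s, (C z - w z x) := fun n => (h2 n).trans <|
    Finset.sum_le_sum fun z _ => by
      rw [birkhoffSum_coboundary (hwe z)]
      exact sub_le_sub_right (hC z ⟨_, rfl⟩) _
  have := h3 ((∑ z ∈ s, (C z - w z x)).toNat + 1)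
  omega

/-- `K`-equivalent clopen sets are mapped onto each other along orbits, by continuous times. -/
lemma IsGoodSystem.exists_orbit_bijection (hK : IsGoodSystem K) (hgK : K ⊆ invariantMeasures g)
    (hg : ∀ U V, IsClopen U → IsClopen V → KEquiv K U V →
      ∃ w : X → ℤ, Continuous w ∧ ∀ x, surplus U V x = w (g x) - w x)
    {U V : Set X} (hU : IsClopen U) (hV : IsClopen V) (hUV : KEquiv K U V) :
    ∃ e : X → ℕ, Continuous e ∧ InjOn (fun x => g^[e x] x) U ∧ (fun x => g^[e x] x) '' U = V := by
  obtain ⟨w, hw, hwe⟩ := hg U V hU hV hUV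
  obtain ⟨e, he, hinj, hmaps⟩ := exists_matching g hU hV fun x _ => by
    -- the partial sums vanish at times of return to the level set of `w` that contains `x`
    obtain ⟨n, hn⟩ := hK.exists_iterate_mem hg (isClopen_preimage_discrete hw {w x}).isOpen
      ⟨x, rfl⟩ (g x)
    refine ⟨n, le_of_eq ?_⟩
    have : w (g^[n] (g x)) = w x := hn
    rw [birkhoffSum_coboundary hwe, Function.iterate_succ_apply, this, sub_self]
  refine ⟨e, he, hinj, hmaps.image_subset.antisymm ?_⟩
  rw [← sdiff_eq_empty]
  by_contra hne
  obtain ⟨μ, hμ⟩ := hK.nonempty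
  have hC := isClopen_image_iterate g hU he
  have h1 := measureReal_pos_of_isClopen (hK.fullSupport μ hμ) (hV.diff hC)
    (nonempty_iff_ne_empty.2 hne)
  rw [measureReal_sdiff hmaps.image_subset hC.isOpen.measurableSet, measureReal_def _ (_ '' _),
    measure_image_iterate hU he hinj (hgK hμ), ← measureReal_def, hUV μ hμ, sub_self] at h1
  exact h1.false

/-- A homeomorphism moving points along orbits by a continuous time is in `[[g]]`. -/
lemma mem_topologicalFullGroup_of_continuous {k : X ≃ₜ X} {e : X → ℕ} (he : Continuous e)
    (hk : ∀ x, k x = g^[e x] x) : k ∈ topologicalFullGroup g := by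
  obtain ⟨N, hN⟩ := (isCompact_range he).bddAbove
  refine ⟨N + 1, fun i => e ⁻¹' {(i : ℕ)}, fun i => (i : ℕ),
    fun i => isClopen_preimage_discrete he _, fun i j hij => ?_, ?_, fun i x hx => ?_⟩
  · exact disjoint_left.2 fun x hx hx' => hij (Fin.ext (hx.symm.trans hx'))
  · exact eq_univ_of_forall fun x =>
      mem_iUnion.2 ⟨⟨e x, Nat.lt_succ_of_le (hN ⟨x, rfl⟩)⟩, rfl⟩
  · rw [hk, zpow_natCast_apply, show e x = i from hx]

/-- Elements of the closure of `[g]` preserve the measures in `K`, hence are approximated by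
elements of `[[g]]` with the same action on the members of a fine clopen partition. -/
lemma IsGoodSystem.isSaturated (hK : IsGoodSystem K) (hgK : K ⊆ invariantMeasures g)
    (hg : ∀ U V, IsClopen U → IsClopen V → KEquiv K U V →
      ∃ w : X → ℤ, Continuous w ∧ ∀ x, surplus U V x = w (g x) - w x) : IsSaturated g := by
  refine ⟨fun h hh => subset_closure fun x => ?_, fun h hh => ?_⟩
  · obtain ⟨k, A, n, -, -, hA, hn⟩ := hh
    obtain ⟨i, hi⟩ := mem_iUnion.1 (hA.symm ▸ mem_univ x : x ∈ ⋃ i, A i)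
    exact ⟨n i, hn i x hi⟩
  have hind : IsInducing fun h : X ≃ₜ X => (h : C(X, X)) := ⟨rfl⟩
  have hequiv : ∀ Q, IsClopen Q → KEquiv K (h ⁻¹' Q) Q := by
    intro Q hQ μ hμ
    have hP := hQ.preimage h.continuous
    have hopen : IsOpen {k : X ≃ₜ X | MapsTo k (h ⁻¹' Q) Q ∧ MapsTo k (h ⁻¹' Q)ᶜ Qᶜ} :=
      ((ContinuousMap.isOpen_setOfPred_mapsTo hP.isClosed.isCompact hQ.isOpen).preimage
        hind.continuous).inter ((ContinuousMap.isOpen_setOfPred_mapsTo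
          hP.compl.isClosed.isCompact hQ.compl.isOpen).preimage hind.continuous)
    obtain ⟨k, ⟨hk1, hk2⟩, hk⟩ := mem_closure_iff.1 hh _ hopen ⟨fun x hx => hx, fun x hx => hx⟩
    have hkQ : k ⁻¹' Q = h ⁻¹' Q := by
      ext x
      by_cases hx : x ∈ h ⁻¹' Q
      · exact iff_of_true (hk1 hx) hx
      · exact iff_of_false (hk2 hx) hx
    have hkμ : μ ∈ invariantMeasures k := mem_invariantMeasures_of_forall_exists_eq
      (fun n : ℤ => g ^ n) (fun n => mem_invariantMeasures_zpow (hgK hμ) n) hk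
    rw [← hkQ, measureReal_def, measure_preimage_of_mem_invariantMeasures hkμ, measureReal_def]
  let := TopologicalSpace.metrizableSpaceMetric X
  rw [hind.closure_eq_preimage_closure_image, mem_preimage, Metric.mem_closure_iff]
  intro ε hε
  obtain ⟨N, Q, hQ, hQu, hQd⟩ :=
    TopologicalSpace.IsOpenCover.exists_finite_nonempty_disjoint_clopen_cover
      (U := fun x : X => ⟨Metric.ball x (ε / 2), Metric.isOpen_ball⟩)
      (TopologicalSpace.Opens.ext (by
        rw [TopologicalSpace.Opens.coe_iSup]
        exact eq_univ_of_forall fun x => mem_iUnion.2 ⟨x, Metric.mem_ball_self (half_pos hε)⟩))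
  choose i hi using fun x => mem_iUnion.1 (hQu (mem_univ x))
  have hi' : ∀ j x, x ∈ (Q j : Set X) → i x = j := fun j x hx => by
    by_contra hne
    have := TopologicalSpace.Clopens.coe_disjoint.2 (hQd hne)
    exact disjoint_left.1 this (hi x) hx
  have hic : Continuous i := continuous_discrete_rng.2 fun j => by
    have : i ⁻¹' {j} = (Q j : Set X) := by
      ext x
      exact ⟨fun h => h ▸ hi x, hi' j x⟩
    rw [this]
    exact (Q j).isClopen.isOpen
  choose e he hinj him using fun j => hK.exists_orbit_bijection hgK hg
    ((Q j).isClopen.preimage h.continuous) (Q j).isClopen (hequiv _ (Q j).isClopen)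
  have hE : Continuous fun x => e (i (h x)) x := by
    have : Continuous fun p : Fin N × X => e p.1 p.2 := continuous_prod_of_discrete_left.2 he
    exact this.comp ((hic.comp h.continuous).prodMk continuous_id)
  have hmem : ∀ x, g^[e (i (h x)) x] x ∈ (Q (i (h x)) : Set X) := fun x =>
    him (i (h x)) ▸ mem_image_of_mem _ (hi (h x))
  let f : X → X := fun x => g^[e (i (h x)) x] x
  have hf : Continuous f := by
    have : Continuous fun p : ℕ × X => g^[p.1] p.2 :=
      continuous_prod_of_discrete_left.2 fun n => g.continuous.iterate n
    exact this.comp (hE.prodMk continuous_id)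
  have hbij : Function.Bijective f := by
    refine ⟨fun x y hxy => ?_, fun y => ?_⟩
    · have h1 : i (h x) = i (h y) := by
        rw [← hi' _ _ (hmem x), ← hi' _ _ (hmem y)]
        exact congrArg i hxy
      refine hinj (i (h x)) (hi (h x)) (show h y ∈ (Q (i (h x)) : Set X) from h1 ▸ hi (h y)) ?_
      change g^[e (i (h x)) x] x = g^[e (i (h x)) y] y
      rw [show g^[e (i (h x)) y] y = f y from by rw [h1]]
      exact hxy
    · obtain ⟨x, hx, hxy⟩ := (him (i y)).symm ▸ hi y
      refine ⟨x, ?_⟩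
      have h1 : i (h x) = i y := hi' _ _ hx
      change g^[e (i (h x)) x] x = y
      rw [h1]
      exact hxy
  let k : X ≃ₜ X :=
    (show Continuous (Equiv.ofBijective f hbij) from hf).homeoOfEquivCompactToT2
  refine ⟨_, ⟨k, mem_topologicalFullGroup_of_continuous (k := k) hE fun x => rfl, rfl⟩, ?_⟩
  refine (ContinuousMap.dist_lt_iff hε).2 fun x => ?_
  obtain ⟨y, hy⟩ := (hQ (i (h x))).2
  have h1 : dist (h x) y < ε / 2 := hy (hi (h x))
  have h2 : dist (k x) y < ε / 2 := hy (hmem x)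
  calc dist (h x) (k x) ≤ dist (h x) y + dist (k x) y := dist_triangle_right _ _ _
    _ < ε := by linarith

/-- A good system is the set of invariant measures of a saturated minimal homeomorphism, if it is
convex. -/
theorem IsGoodSystem.exists_saturated (hK : IsGoodSystem K) [Nonempty X] [PerfectSpace X]
    (hconv : Convex ℝ≥0 (ProbabilityMeasure.toFiniteMeasure '' K)) :
    ∃ g : X ≃ₜ X, IsMinimalHomeo g ∧ invariantMeasures g = K ∧ IsSaturated g := by
  obtain ⟨g, hgK, hg⟩ := hK.exists_homeo_coboundary
  refine ⟨g, fun x => ?_, Subset.antisymm (fun ν hν => ?_) hgK, hK.isSaturated hgK hg⟩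
  · refine dense_iff_inter_open.2 fun O hO hne => ?_
    obtain ⟨n, hn⟩ := hK.exists_iterate_mem hg hO hne x
    exact ⟨_, hn, n, zpow_natCast_apply g n x⟩
  · refine hK.mem_of_mem_respecting hconv fun U V hU hV hUV => ?_
    obtain ⟨w, hw, hwe⟩ := hg U V hU hV hUV
    rw [← sub_eq_zero, ← integral_surplus hU hV]
    simp only [hwe]
    have hwg : Continuous fun x => w (g x) := hw.comp g.continuous
    rw [integral_sub_intCast hwg hw]
    exact sub_eq_zero.2 (integral_comp_of_mem_invariantMeasures hν fun x => (w x : ℝ))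

end Conclusion

end CantorDynamics

/-- `X` is a Cantor space: nonempty, compact, metrizable, totally disconnected, without isolated
points. -/
theorem theorem1 {X : Type*} [TopologicalSpace X] [Nonempty X] [CompactSpace X]
    [TopologicalSpace.MetrizableSpace X] [TotallyDisconnectedSpace X] [PerfectSpace X]
    [MeasurableSpace X] [BorelSpace X] (K : Set (ProbabilityMeasure X)) :
    ((∃ g : X ≃ₜ X, IsMinimalHomeo g ∧ invariantMeasures g = K) ↔ IsDynamicalSimplex K) ∧
      (IsDynamicalSimplex K →
        ∃ g : X ≃ₜ X, IsMinimalHomeo g ∧ invariantMeasures g = K ∧ IsSaturated g) := by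
  have hsat : IsDynamicalSimplex K →
      ∃ g : X ≃ₜ X, IsMinimalHomeo g ∧ invariantMeasures g = K ∧ IsSaturated g := fun h =>
    IsGoodSystem.exists_saturated ⟨h.nonempty, h.isCompact, h.atomless, h.fullSupport, h.good⟩
      h.convex
  refine ⟨⟨?_, fun h => ?_⟩, hsat⟩
  · rintro ⟨g, hg, rfl⟩
    have hK := hg.isGoodSystem
    exact ⟨hK.nonempty, hK.isCompact, convex_invariantMeasures g, hK.atomless, hK.fullSupport,
      hK.good, hK.isApproximatelyDivisible⟩
  · obtain ⟨g, hg, hgK, -⟩ := hsat h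
    exact ⟨g, hg, hgK⟩
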